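/- **Setting.** There are $N$ agents. Agent $i$ chooses $x_i\in\Omega_i\subseteq\mathbb R^{n_i}$ and has the cost $$\mathbb J_i(x_i,x_{-i})=\mathbb E[f_i(x,\xi_i)]+g_i(x_i),$$ where $\xi=(\xi_1,\dots,\xi_N)$ is a random variable with law $\mathbb P$ on $\Xi_1\times\dots\times\Xi_N$. The agents share the constraints $Ax:=\sum_iA_ix_i\le b:=\sum_ib_i$ in $\mathbb R^m$. Put $\Omega=\prod_i\Omega_i$, $\mathcal X=\{x\in\Omega: Ax\le b\}$, $F_i(x)=\mathbb E[\nabla_{x_i}f_i(x,\xi_i)]$ and $F=\mathrm{col}(F_i)$. Let $D=\prod_iD_i$ with $D_i\supseteq\Omega_i$ convex be the domain on which $F$ is considered (for instance $D=\Omega$ or $D=\mathbb R^n$). A point $x^*\in\mathcal X$ is an SGNE if, for every $i$, $x_i^*$ minimizes $\mathbb J_i(\cdot,x^*_{-i})$ over $\{y\in\Omega_i: A_iy\le b-\sum_{j\ne i}A_jx_j^*\}$. It is a variational SGNE (v-SGNE) if, moreover, there is $v\in\prod_i\partial g_i(x_i^*)$ with $\langle F(x^*)+v,\,y-x^*\rangle\ge0$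 for all $y\in\mathcal X$. **Assumptions.** 1. Each $g_i$ is convex and lower semicontinuous with domain $\Omega_i$, and $\Omega_i$ is nonempty, compact and convex. 2. Slater's condition holds: some $x\in\Omega$ satisfies $Ax<b$ componentwise. 3. Each $f_i$ is measurable and $f_i(x,\xi_i)$ is integrable for $x\in\Omega$. For every $\xi_i$, the function $f_i(\cdot,x_{-i},\xi_i)$ is convex on $\Omega_i$ and Lipschitz on $\Omega_i$ with a constant integrable in $\xi_i$ (for $x_{-i}\in\Omega_{-i}$), and continuously differentiable (for $x_{-i}\in D_{-i}$). Moreover $\nabla_{x_i}f_i(x,\xi_i)$ is integrable for $x\in D$. 4. On $D$, $F$ is $\eta$-strongly monotone and $\ell_F$-Lipschitz, with $\eta,\ell_F>0$. Let $\ell_p>0$ be a Lipschitz constant on $D^N$ of the extended pseudogradient $(\hat x_1,\dots,\hat x_N)\mapsto\mathrm{col}(F_i(\hat x_i))$; one may always take $\ell_p=\ell_F$. 5. The communication graph is undirected and connected, with symmetric weights $w_{ij}>0$ on its edges ($w_{ij}=0$ otherwise) and weighted Laplacian $L$. 6. The batch sizes $M_k\ge1$ satisfy $M_k\ge c_0(k+k_0)^{a+1}$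 for all $k\ge1$, for some $c_0,k_0,a>0$. 7. Sampling: batch $k$ consists of the samples $\xi^{(k,t)}$, $t<M_k$. All samples (over all $k$ and $t$) are independent with law $\mathbb P$, and they are independent of the (possibly random) initial state. Hence the sampling error has zero conditional mean given the past. Its variance is bounded: for some $\sigma$, $\mathbb E\big[\sum_i\|\nabla_{x_i}f_i(x,\xi_i)-F_i(x)\|^2\big]\le\sigma^2$ for all $x\in D$. 8. The gain $c$ satisfies $c\,\lambda_2(L)>\frac{(\ell_p+\ell_F)^2}{4\eta}+\ell_p$, where $\lambda_2(L)$ is the smallest nonzero eigenvalue of $L$ (no condition if $N=1$). **Algorithm.** Agent $i$ keeps an estimate $\hat x_{i,j}$ of $x_j$ for every $j$, with $\hat x_{i,i}=x_i$; write $\hat x_i=(\hat x_{i,j})_j$. Start from any $x_i^0\in\Omega_i$, $\hat x_{i,j}^0\in D_j$, $z_i^0\in\mathbb R^m$, $\lambda_i^0\in\mathbb R^m_{\ge0}$, and iterate $$\begin{aligned} x_i^{k+1}&=\mathrm{prox}_{\alpha_ig_i}\Big[x_i^k-\alpha_i\Big(\tfrac1{M_k}\sum_{t<M_k}\nabla_{x_i}f_i(\hat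 x_i^k,\xi_i^{(k,t)})+A_i^\top\lambda_i^k+c\sum_jw_{ij}(x_i^k-\hat x_{j,i}^k)\Big)\Big],\\ \hat x_{i,j}^{k+1}&=\hat x_{i,j}^k-\alpha_ic\sum_hw_{ih}(\hat x_{i,j}^k-\hat x_{h,j}^k)\qquad(j\ne i),\\ z_i^{k+1}&=z_i^k+\nu_i\sum_jw_{ij}(\lambda_i^k-\lambda_j^k),\\ \lambda_i^{k+1}&=\mathrm{proj}_{\mathbb R^m_{\ge0}}\Big[\lambda_i^k+\delta_i\Big(A_i(2x_i^{k+1}-x_i^k)-b_i-\sum_jw_{ij}\big(2(z_i^{k+1}-z_j^{k+1})-(z_i^k-z_j^k)\big)\Big)\Big]. \end{aligned}$$ **Theorem.** Under these assumptions the game has exactly one v-SGNE $x^*$, and there are $\bar\alpha,\bar\nu,\bar\delta>0$ such that, for all $\alpha_i\in(0,\bar\alpha)$, $\nu_i\in(0,\bar\nu)$ and $\delta_i\in(0,\bar\delta)$ ($i=1,\dots,N$), the sequence $x^k=(x_1^k,\dots,x_N^k)$ generated by the algorithm converges almost surely to $x^*$. The bounds do not depend on the batch sizes, the samples or the initial state.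 -/

import Mathlib

open MeasureTheory ProbabilityTheory Filter Topology
open scoped RealInnerProductSpace ENNReal

noncomputable section

namespace SGNE

/-- Collective decisions `x = col(x_1, …, x_N)` with `x_i ∈ ℝ^{n_i}`. (This is a plain product:
Euclidean norms of stacked vectors are written out below as sums over the blocks.) -/
abbrev Dec {N : ℕ} (n : Fin N → ℕ) : Type := ∀ i : Fin N, EuclideanSpace ℝ (Fin (n i))

/-- The data of a stochastic generalized game with `N` agents and `m` affine coupling constraints.
Agent `i` has cost `𝔼[f_i(x, ξ_i)] + g_i(x_i)`, where `ξ = (ξ_1, …, ξ_N)` has law `P` on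
`Ξ_1 × ⋯ × Ξ_N` (each `Ξ_i` may be a subset of some `ℝ^d`). The extended-valued function `g_i`
is represented by its effective domain `Ω i` and by its (real) values there; it is `+∞` outside
`Ω i`. The values of `g i` outside `Ω i` are never used. The coupling constraints are
`∑ i, A_i x_i ≤ ∑ i, b_i`, where agent `i` knows `A_i` and `b_i`. -/
structure Game {N : ℕ} (m : ℕ) (n : Fin N → ℕ) (Ξ : Fin N → Type*)
    [∀ i, MeasurableSpace (Ξ i)] where
  P : Measure (∀ i, Ξ i)
  f : ∀ i : Fin N, Dec n → Ξ i → ℝ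
  g : ∀ i : Fin N, EuclideanSpace ℝ (Fin (n i)) → ℝ
  Ω : ∀ i : Fin N, Set (EuclideanSpace ℝ (Fin (n i)))
  A : ∀ i : Fin N, Matrix (Fin m) (Fin (n i)) ℝ
  b : Fin N → Fin m → ℝ

namespace Game

variable {N m : ℕ} {n : Fin N → ℕ} {Ξ : Fin N → Type*} [∀ i, MeasurableSpace (Ξ i)]

/-- `A_i y`. -/
def mulA (𝒢 : Game m n Ξ) (i : Fin N) (y : EuclideanSpace ℝ (Fin (n i))) : Fin m → ℝ :=
  (𝒢.A i).mulVec (WithLp.ofLp y)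

/-- `A_iᵀ l`. -/
def mulAT (𝒢 : Game m n Ξ) (i : Fin N) (l : Fin m → ℝ) : EuclideanSpace ℝ (Fin (n i)) :=
  WithLp.toLp 2 ((𝒢.A i).transpose.mulVec l)

/-- The partial gradient `∇_{x_i} f_i(x_i, x_{-i}, ξ_i)`. -/
def grad (𝒢 : Game m n Ξ) (i : Fin N) (x : Dec n) (ξ : Ξ i) : EuclideanSpace ℝ (Fin (n i)) :=
  gradient (fun y => 𝒢.f i (Function.update x i y) ξ) (x i)

/-- The `i`-th block `𝔼[∇_{x_i} f_i(x, ξ_i)]` of the pseudogradient. -/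
def F (𝒢 : Game m n Ξ) (i : Fin N) (x : Dec n) : EuclideanSpace ℝ (Fin (n i)) :=
  ∫ ξ, 𝒢.grad i x (ξ i) ∂𝒢.P

/-- The sampled partial gradient `M⁻¹ ∑_{t < M} ∇_{x_i} f_i(x, ξ_i^{(t)})`. -/
def sampledF (𝒢 : Game m n Ξ) (i : Fin N) (M : ℕ) (x : Dec n) (s : ℕ → Ξ i) :
    EuclideanSpace ℝ (Fin (n i)) :=
  (M : ℝ)⁻¹ • ∑ t ∈ Finset.range M, 𝒢.grad i x (s t)

/-- The cost `𝔼[f_i(x, ξ_i)] + g_i(x_i)` of agent `i` (for `x_i ∈ Ω_i`). -/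
def cost (𝒢 : Game m n Ξ) (i : Fin N) (x : Dec n) : ℝ :=
  ∫ ξ, 𝒢.f i x (ξ i) ∂𝒢.P + 𝒢.g i (x i)

/-- The collective feasible set `{x ∈ ∏ Ω_i | A x ≤ b}`. -/
def feasible (𝒢 : Game m n Ξ) : Set (Dec n) :=
  {x | (∀ i, x i ∈ 𝒢.Ω i) ∧ ∑ i, 𝒢.mulA i (x i) ≤ ∑ i, 𝒢.b i}

/-- The feasible set of agent `i`: `{y ∈ Ω_i | A_i y ≤ b - ∑_{j ≠ i} A_j x_j}`. -/
def localFeasible (𝒢 : Game m n Ξ) (i : Fin N) (x : Dec n) :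
    Set (EuclideanSpace ℝ (Fin (n i))) :=
  {y | y ∈ 𝒢.Ω i ∧
    𝒢.mulA i y ≤ ∑ j, 𝒢.b j - ∑ j ∈ Finset.univ.erase i, 𝒢.mulA j (x j)}

/-- Stochastic generalized Nash equilibrium. -/
def IsSGNE (𝒢 : Game m n Ξ) (x : Dec n) : Prop :=
  x ∈ 𝒢.feasible ∧
    ∀ i, ∀ y ∈ 𝒢.localFeasible i x, 𝒢.cost i x ≤ 𝒢.cost i (Function.update x i y)

/-- The convex subdifferential of (the extended-valued function) `g_i` at `p`. -/
def subdiff (𝒢 : Game m n Ξ) (i : Fin N) (p : EuclideanSpace ℝ (Fin (n i))) :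
    Set (EuclideanSpace ℝ (Fin (n i))) :=
  {v | p ∈ 𝒢.Ω i ∧ ∀ y ∈ 𝒢.Ω i, 𝒢.g i p + ⟪v, y - p⟫ ≤ 𝒢.g i y}

/-- `x` solves the stochastic variational inequality associated with the set-valued map
`F + ∂g_1 × ⋯ × ∂g_N` on the collective feasible set. -/
def SolvesSVI (𝒢 : Game m n Ξ) (x : Dec n) : Prop :=
  x ∈ 𝒢.feasible ∧ ∃ v : Dec n, (∀ i, v i ∈ 𝒢.subdiff i (x i)) ∧
    ∀ y ∈ 𝒢.feasible, 0 ≤ ∑ i, ⟪𝒢.F i x + v i, y i - x i⟫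

/-- Variational stochastic generalized Nash equilibrium. -/
def IsVSGNE (𝒢 : Game m n Ξ) (x : Dec n) : Prop :=
  𝒢.IsSGNE x ∧ 𝒢.SolvesSVI x

/-- `p = prox_{a g_i}(v)`, the minimizer of `a g_i(y) + ½‖y - v‖²`. -/
def IsProx (𝒢 : Game m n Ξ) (i : Fin N) (a : ℝ) (v p : EuclideanSpace ℝ (Fin (n i))) : Prop :=
  p ∈ 𝒢.Ω i ∧ ∀ y ∈ 𝒢.Ω i,
    a * 𝒢.g i p + ‖p - v‖ ^ 2 / 2 ≤ a * 𝒢.g i y + ‖y - v‖ ^ 2 / 2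

/-- Local costs, constraint qualification and sampling model. The convex sets `D i ⊇ Ω i` are such
that the pseudogradient is considered on `∏ D_i` (for instance `D i = Ω i`, or `D i` the whole
space). -/
structure Regular (𝒢 : Game m n Ξ) (D : ∀ i, Set (EuclideanSpace ℝ (Fin (n i)))) : Prop where
  prob : IsProbabilityMeasure 𝒢.P
  /- the nonsmooth parts and the local feasible sets -/
  nonempty : ∀ i, (𝒢.Ω i).Nonempty
  compact : ∀ i, IsCompact (𝒢.Ω i)
  convex : ∀ i, Convex ℝ (𝒢.Ω i)
  g_convex : ∀ i, ConvexOn ℝ (𝒢.Ω i) (𝒢.g i)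
  g_lsc : ∀ i, LowerSemicontinuousOn (𝒢.g i) (𝒢.Ω i)
  /- Slater's condition -/
  slater : ∃ x : Dec n, (∀ i, x i ∈ 𝒢.Ω i) ∧
    ∀ r, (∑ i, 𝒢.mulA i (x i)) r < (∑ i, 𝒢.b i) r
  /- the domain of the pseudogradient -/
  subset_dom : ∀ i, 𝒢.Ω i ⊆ D i
  convex_dom : ∀ i, Convex ℝ (D i)
  /- the smooth parts -/
  f_meas : ∀ i, Measurable (Function.uncurry (𝒢.f i))
  f_integrable : ∀ i, ∀ x : Dec n, (∀ j, x j ∈ 𝒢.Ω j) →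
    Integrable (fun ξ => 𝒢.f i x (ξ i)) 𝒢.P
  f_convex : ∀ i, ∀ x : Dec n, (∀ j, x j ∈ 𝒢.Ω j) → ∀ ξ : Ξ i,
    ConvexOn ℝ (𝒢.Ω i) (fun y => 𝒢.f i (Function.update x i y) ξ)
  f_smooth : ∀ i, ∀ x : Dec n, (∀ j, x j ∈ D j) → ∀ ξ : Ξ i,
    ContDiff ℝ 1 (fun y => 𝒢.f i (Function.update x i y) ξ)
  f_lipschitz : ∀ i, ∀ x : Dec n, (∀ j, x j ∈ 𝒢.Ω j) → ∃ K : Ξ i → NNReal,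
    Integrable (fun ξ => (K (ξ i) : ℝ)) 𝒢.P ∧
    ∀ ξ : Ξ i, LipschitzOnWith (K ξ) (fun y => 𝒢.f i (Function.update x i y) ξ) (𝒢.Ω i)
  grad_integrable : ∀ i, ∀ x : Dec n, (∀ j, x j ∈ D j) →
    Integrable (fun ξ => 𝒢.grad i x (ξ i)) 𝒢.P

/-- The pseudogradient is `η`-strongly monotone on `∏ D_i`. -/
def StronglyMonotone (𝒢 : Game m n Ξ) (D : ∀ i, Set (EuclideanSpace ℝ (Fin (n i)))) (η : ℝ) :
    Prop :=
  ∀ x y : Dec n, (∀ j, x j ∈ D j) → (∀ j, y j ∈ D j) →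
    η * ∑ i, ‖x i - y i‖ ^ 2 ≤ ∑ i, ⟪𝒢.F i x - 𝒢.F i y, x i - y i⟫

/-- The pseudogradient is `ℓ`-Lipschitz on `∏ D_i`. -/
def Lipschitz (𝒢 : Game m n Ξ) (D : ∀ i, Set (EuclideanSpace ℝ (Fin (n i)))) (ℓ : ℝ) : Prop :=
  ∀ x y : Dec n, (∀ j, x j ∈ D j) → (∀ j, y j ∈ D j) →
    √(∑ i, ‖𝒢.F i x - 𝒢.F i y‖ ^ 2) ≤ ℓ * √(∑ i, ‖x i - y i‖ ^ 2)

/-- The extended pseudogradient `X ↦ col(F_i(X_i))`, whose argument `X = (X_1, …, X_N)` collects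
one estimate of the whole decision vector per agent, is `ℓ`-Lipschitz on `(∏ D_i)^N`. -/
def ExtLipschitz (𝒢 : Game m n Ξ) (D : ∀ i, Set (EuclideanSpace ℝ (Fin (n i)))) (ℓ : ℝ) : Prop :=
  ∀ X Y : Fin N → Dec n, (∀ i j, X i j ∈ D j) → (∀ i j, Y i j ∈ D j) →
    √(∑ i, ‖𝒢.F i (X i) - 𝒢.F i (Y i)‖ ^ 2) ≤ ℓ * √(∑ i, ∑ j, ‖X i j - Y i j‖ ^ 2)

/-- The sampling error has variance at most `σ²` on `∏ D_i`. -/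
def BoundedVariance (𝒢 : Game m n Ξ) (D : ∀ i, Set (EuclideanSpace ℝ (Fin (n i)))) (σ : ℝ) :
    Prop :=
  ∀ x : Dec n, (∀ j, x j ∈ D j) →
    ∫⁻ ξ, ∑ i, ‖𝒢.grad i x (ξ i) - 𝒢.F i x‖ₑ ^ 2 ∂𝒢.P ≤ ENNReal.ofReal (σ ^ 2)

end Game

/-- `W` is a weighted adjacency matrix of the undirected graph `G`. -/
structure IsWeightMatrix {N : ℕ} (G : SimpleGraph (Fin N)) (W : Matrix (Fin N) (Fin N) ℝ) :
    Prop where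
  symm : ∀ i j, W i j = W j i
  pos : ∀ i j, G.Adj i j → 0 < W i j
  zero : ∀ i j, ¬ G.Adj i j → W i j = 0

/-- The weighted Laplacian `L = diag(d_1, …, d_N) - W`, where `d_i = ∑ j, w_{ij}`. -/
def laplacian {N : ℕ} (W : Matrix (Fin N) (Fin N) ℝ) : Matrix (Fin N) (Fin N) ℝ :=
  Matrix.diagonal (fun i => ∑ j, W i j) - W

/-- One trajectory of the node-based preconditioned forward-backward algorithm, for given samples
`s k t = (ξ_1^{(k,t)}, …, ξ_N^{(k,t)})`. Here `X k i j` is the estimate that agent `i` has of the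
decision of agent `j` at time `k`, and `X k i i` is the decision of agent `i` itself. The sums over
the neighbours of `i` are written as sums over all agents, since `W` vanishes off the edges. -/
structure IsTrajectory {N m : ℕ} {n : Fin N → ℕ} {Ξ : Fin N → Type*} [∀ i, MeasurableSpace (Ξ i)]
    (𝒢 : Game m n Ξ) (W : Matrix (Fin N) (Fin N) ℝ) (c : ℝ) (α ν δ : Fin N → ℝ) (M : ℕ → ℕ)
    (s : ℕ → ℕ → ∀ i, Ξ i) (X : ℕ → Fin N → Dec n) (z l : ℕ → Fin N → Fin m → ℝ) : Prop where
  decision : ∀ k i, 𝒢.IsProx i (α i)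
    (X k i i - α i • (𝒢.sampledF i (M k) (X k i) (fun t => s k t i) + 𝒢.mulAT i (l k i)
      + c • ∑ j, W i j • (X k i i - X k j i)))
    (X (k + 1) i i)
  estimate : ∀ k i j, j ≠ i →
    X (k + 1) i j = X k i j - (α i * c) • ∑ h, W i h • (X k i j - X k h j)
  auxiliary : ∀ k i,
    z (k + 1) i = z k i + ν i • ∑ j, W i j • (l k i - l k j)
  /- the projection onto the nonnegative orthant is the componentwise maximum with `0` -/
  dual : ∀ k i,
    l (k + 1) i = (l k i + δ i • (𝒢.mulA i ((2 : ℝ) • X (k + 1) i i - X k i i) - 𝒢.b i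
      - ∑ j, W i j • ((2 : ℝ) • (z (k + 1) i - z (k + 1) j) - (z k i - z k j)))) ⊔ 0

/-- A random run of the algorithm on the probability space `(S, μ)`: batch `k` consists of the
samples `ξ k t`, `t < M k`; all the samples are independent with law `P`, the (possibly random)
initial state is independent of them, and the iterates follow the algorithm. -/
structure IsRun {N m : ℕ} {n : Fin N → ℕ} {Ξ : Fin N → Type*} [∀ i, MeasurableSpace (Ξ i)]
    (𝒢 : Game m n Ξ) (D : ∀ i, Set (EuclideanSpace ℝ (Fin (n i))))
    (W : Matrix (Fin N) (Fin N) ℝ) (c : ℝ) (α ν δ : Fin N → ℝ) (M : ℕ → ℕ)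
    {S : Type*} [MeasurableSpace S] (μ : Measure S) (ξ : ℕ → ℕ → S → ∀ i, Ξ i)
    (X : ℕ → S → Fin N → Dec n) (z l : ℕ → S → Fin N → Fin m → ℝ) : Prop where
  sample_meas : ∀ k t, Measurable (ξ k t)
  sample_law : ∀ k t, Measure.map (ξ k t) μ = 𝒢.P
  sample_indep : iIndepFun (fun p : ℕ × ℕ => ξ p.1 p.2) μ
  init_meas : Measurable (fun ω => (X 0 ω, z 0 ω, l 0 ω))
  init_indep : IndepFun (fun ω => (X 0 ω, z 0 ω, l 0 ω)) (fun ω (p : ℕ × ℕ) => ξ p.1 p.2 ω) μ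
  init_decision : ∀ ω i, X 0 ω i i ∈ 𝒢.Ω i
  init_estimate : ∀ ω i j, X 0 ω i j ∈ D j
  init_dual : ∀ ω i, 0 ≤ l 0 ω i
  trajectory : ∀ ω, IsTrajectory 𝒢 W c α ν δ M (fun k t => ξ k t ω) (fun k => X k ω)
    (fun k => z k ω) (fun k => l k ω)

end SGNE

end

/-! Equilibrium. A prox-gradient map has a fixed point on the compact feasible set, and this point
solves the mixed variational inequality (`exists_variational_solution`). The solution minimizes a
convex function linearized at itself, so Slater's condition yields one multiplier shared by all
agents (`exists_multiplier`, `Game.exists_isKKT`). A KKT point is a v-SGNE, and strong monotonicity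
makes it unique.

Convergence. The algorithm is a forward-backward iteration in the metric `precond`, whose
off-diagonal blocks make the backward step computable agent by agent. The forward operator,
pseudogradient plus consensus term, is strongly monotone relative to consensual points
(`exists_restricted_strong_monotonicity`): the pseudogradient controls the average of the estimates,
the Laplacian controls their disagreement, and the condition on `c` dominates the cross terms. With
V_k the squared distance to a KKT point in this metric, S_k the squared distance of the estimates to
the equilibrium and E_k the squared sampling error, every path satisfies V_{k+1} + (κ/4) S_k ≤ V_k +
C E_k. Small step sizes make the metric positive and absorb the forward-step error.

Noise. Young's inequality charges the noise to E_k, so no supermartingale theorem is needed: ∑ E_k <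
∞ on a path already forces S_k → 0. The iterate depends only on the initial state and earlier
batches, hence is independent of batch k, and averaging gives 𝔼 E_k = O(1/M_k). This is summable, so
∑ E_k is almost surely finite (`IsRun.ae_summable_sampling_error`). -/

noncomputable section

namespace SGNE

/-! ### Proximal maps and mixed variational inequalities. -/

section ConvexAnalysis

variable {E : Type*} [NormedAddCommGroup E] [InnerProductSpace ℝ E]

theorem le_of_forall_le_add_mul {A B C : ℝ} (hC : 0 ≤ C)
    (h : ∀ t : ℝ, 0 < t → t ≤ 1 → A ≤ B + t * C) : A ≤ B := by
  by_contra! hAB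
  have hpos : 0 < (A - B) / (2 * (C + 1)) := div_pos (by linarith) (by linarith)
  have h1 := h (min 1 ((A - B) / (2 * (C + 1)))) (lt_min one_pos hpos) (min_le_left _ _)
  have h2 : min 1 ((A - B) / (2 * (C + 1))) * C ≤ (A - B) / (2 * (C + 1)) * (C + 1) :=
    mul_le_mul (min_le_right _ _) (by linarith) hC hpos.le
  have h3 : (A - B) / (2 * (C + 1)) * (C + 1) = (A - B) / 2 := by
    field_simp
  linarith

/-- `p` minimizes `a φ(y) + ½‖y - v‖²` over `y ∈ K`. -/
def IsProxOn (K : Set E) (φ : E → ℝ) (a : ℝ) (v p : E) : Prop :=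
  p ∈ K ∧ ∀ y ∈ K, a * φ p + ‖p - v‖ ^ 2 / 2 ≤ a * φ y + ‖y - v‖ ^ 2 / 2

/-- Compare `p` with points of the segment towards `y`, divide by `t` and let `t` tend to 0; the
quadratic remainder disappears. -/
theorem IsProxOn.variational {K : Set E} {φ : E → ℝ} {a : ℝ} {v p : E}
    (hφ : ConvexOn ℝ K φ) (ha : 0 ≤ a) (h : IsProxOn K φ a v p) {y : E} (hy : y ∈ K) :
    a * φ p ≤ a * φ y + ⟪p - v, y - p⟫ := by
  obtain ⟨hp, hmin⟩ := h
  refine le_of_forall_le_add_mul (C := ‖y - p‖ ^ 2 / 2) (by positivity) fun t ht ht1 => ?_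
  have hmem : (1 - t) • p + t • y ∈ K := hφ.1 hp hy (by linarith) ht.le (by ring)
  have h1 := hmin _ hmem
  have h2 := hφ.2 hp hy (by linarith : (0 : ℝ) ≤ 1 - t) ht.le (by ring)
  simp only [smul_eq_mul] at h2
  have h3 : (1 - t) • p + t • y - v = (p - v) + t • (y - p) := by module
  rw [h3, norm_add_sq_real, inner_smul_right, norm_smul, Real.norm_of_nonneg ht.le] at h1
  have h4 := mul_le_mul_of_nonneg_left h2 ha
  have h5 : t * (a * φ p) ≤ t * (a * φ y + ⟪p - v, y - p⟫ + t * (‖y - p‖ ^ 2 / 2)) := by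
    nlinarith
  exact le_of_mul_le_mul_left h5 ht

/-- Each variational inequality is tested at the other minimizer; their sum and Cauchy–Schwarz give
nonexpansiveness. -/
theorem IsProxOn.norm_sub_le {K : Set E} {φ : E → ℝ} {a : ℝ} {v w p q : E}
    (hφ : ConvexOn ℝ K φ) (ha : 0 ≤ a) (hp : IsProxOn K φ a v p) (hq : IsProxOn K φ a w q) :
    ‖p - q‖ ≤ ‖v - w‖ := by
  have h1 := hp.variational hφ ha hq.1
  have h2 := hq.variational hφ ha hp.1
  have h3 : ⟪p - v, q - p⟫ + ⟪q - w, p - q⟫ = ⟪v - w, p - q⟫ - ‖p - q‖ ^ 2 := by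
    rw [← real_inner_self_eq_norm_sq]
    simp only [inner_sub_left, inner_sub_right]
    ring
  have h4 := real_inner_le_norm (v - w) (p - q)
  have h5 : ‖p - q‖ * ‖p - q‖ ≤ ‖v - w‖ * ‖p - q‖ := by nlinarith
  by_contra! hlt
  have : 0 < ‖p - q‖ := lt_of_le_of_lt (norm_nonneg _) hlt
  exact absurd (le_of_mul_le_mul_right h5 this) (not_le.2 hlt)

theorem exists_isProxOn {E : Type*} [NormedAddCommGroup E] {K : Set E} {φ : E → ℝ}
    {a : ℝ} (hne : K.Nonempty) (hK : IsCompact K)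
    (hφ : LowerSemicontinuousOn φ K) (ha : 0 ≤ a) (v : E) : ∃ p, IsProxOn K φ a v p := by
  have h1 : LowerSemicontinuousOn (fun y => a * φ y + ‖y - v‖ ^ 2 / 2) K := by
    refine LowerSemicontinuousOn.add ?_ (Continuous.continuousOn (by fun_prop)).lowerSemicontinuousOn
    exact (continuous_const_mul a).comp_lowerSemicontinuousOn hφ
      (monotone_mul_left_of_nonneg ha)
  obtain ⟨p, hp, hmin⟩ := h1.exists_isMinOn hne hK
  exact ⟨p, hp, fun y hy => hmin hy⟩

/-- Existence for a mixed variational inequality with a strongly monotone Lipschitz map. -/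
theorem exists_variational_solution {K : Set E} {φ : E → ℝ} {T : E → E} {η ℓ : ℝ}
    (hne : K.Nonempty) (hK : IsCompact K) (hφ : ConvexOn ℝ K φ)
    (hlsc : LowerSemicontinuousOn φ K) (hη : 0 < η) (hℓ : 0 < ℓ)
    (hmono : ∀ x ∈ K, ∀ y ∈ K, η * ‖x - y‖ ^ 2 ≤ ⟪T x - T y, x - y⟫)
    (hlip : ∀ x ∈ K, ∀ y ∈ K, ‖T x - T y‖ ≤ ℓ * ‖x - y‖) :
    ∃ x ∈ K, ∀ y ∈ K, φ x ≤ φ y + ⟪T x, y - x⟫ := by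
  -- This step minimizes 1 - 2γη + γ²ℓ², so the squared distance shrinks by the factor 1 - γη.
  set γ : ℝ := η / ℓ ^ 2 with hγ
  have hγ0 : 0 < γ := by positivity
  choose P hP using fun v => exists_isProxOn hne hK hlsc hγ0.le v
  have hcontr : ∀ x ∈ K, ∀ y ∈ K, x ≠ y → ‖P (x - γ • T x) - P (y - γ • T y)‖ < ‖x - y‖ := by
    intro x hx y hy hxy
    refine lt_of_le_of_lt ((hP _).norm_sub_le hφ hγ0.le (hP _)) ?_
    refine lt_of_pow_lt_pow_left₀ 2 (norm_nonneg _) ?_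
    have e : x - γ • T x - (y - γ • T y) = (x - y) - γ • (T x - T y) := by module
    rw [e, norm_sub_sq_real, inner_smul_right, norm_smul, Real.norm_of_nonneg hγ0.le,
      real_inner_comm]
    have h1 := hmono x hx y hy
    have h2 : ‖T x - T y‖ ^ 2 ≤ ℓ ^ 2 * ‖x - y‖ ^ 2 := by
      rw [← mul_pow]
      exact pow_le_pow_left₀ (norm_nonneg _) (hlip x hx y hy) 2
    have h3 : 0 < ‖x - y‖ ^ 2 := by
      have := norm_pos_iff.2 (sub_ne_zero.2 hxy)
      positivity
    have h4 : γ * ℓ ^ 2 = η := by rw [hγ]; field_simp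
    have h5 : (γ * ‖T x - T y‖) ^ 2 ≤ γ * η * ‖x - y‖ ^ 2 := by
      calc (γ * ‖T x - T y‖) ^ 2 = γ ^ 2 * ‖T x - T y‖ ^ 2 := by ring
        _ ≤ γ ^ 2 * (ℓ ^ 2 * ‖x - y‖ ^ 2) := by gcongr
        _ = γ * (γ * ℓ ^ 2) * ‖x - y‖ ^ 2 := by ring
        _ = γ * η * ‖x - y‖ ^ 2 := by rw [h4]
    have h6 := mul_le_mul_of_nonneg_left h1 hγ0.le
    have h7 : 0 < γ * η * ‖x - y‖ ^ 2 := by positivity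
    nlinarith
  have hle : ∀ x ∈ K, ∀ y ∈ K, ‖P (x - γ • T x) - P (y - γ • T y)‖ ≤ ‖x - y‖ := by
    intro x hx y hy
    rcases eq_or_ne x y with rfl | hxy
    · simp
    · exact (hcontr x hx y hy hxy).le
  have hcont : ContinuousOn (fun x => P (x - γ • T x)) K := by
    refine LipschitzOnWith.continuousOn (K := 1) (LipschitzOnWith.of_dist_le_mul ?_)
    intro x hx y hy
    simpa [dist_eq_norm] using hle x hx y hy
  -- A point of least displacement is fixed, since otherwise its image would have a smaller
  -- displacement. Compactness replaces completeness of `E`.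
  obtain ⟨x, hx, hmin⟩ := hK.exists_isMinOn hne ((hcont.sub continuousOn_id).norm)
  have hfix : P (x - γ • T x) = x := by
    by_contra hne'
    have h1 := hcontr _ (hP (x - γ • T x)).1 x hx hne'
    have h2 := hmin (hP (x - γ • T x)).1
    simp only [Set.mem_ofPred_eq, Pi.sub_apply, id] at h2
    linarith
  refine ⟨x, hx, fun y hy => ?_⟩
  have h1 := (hP (x - γ • T x)).variational hφ hγ0.le hy
  rw [hfix] at h1
  have e : x - (x - γ • T x) = γ • T x := by abel
  rw [e, inner_smul_left] at h1
  simp only [conj_trivial] at h1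
  rw [← mul_add] at h1
  exact le_of_mul_le_mul_left h1 hγ0

end ConvexAnalysis

/-! ### Lagrange multipliers by separation. -/

/-- Lagrange multipliers for a convex program under Slater's condition. -/
theorem exists_multiplier {E ι : Type*} [AddCommGroup E] [Module ℝ E] [Fintype ι]
    {K : Set E} {φ : E → ℝ} {a : ι → E → ℝ} (hφ : ConvexOn ℝ K φ)
    (ha : ∀ r, ConvexOn ℝ K (a r)) (hslater : ∃ y ∈ K, ∀ r, a r y < 0)
    {x : E} (hx : x ∈ K) (hxa : ∀ r, a r x ≤ 0) (hmin : ∀ y ∈ K, (∀ r, a r y ≤ 0) → φ x ≤ φ y) :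
    ∃ μ : ι → ℝ, (∀ r, 0 ≤ μ r) ∧ ∑ r, μ r * a r x = 0 ∧
      ∀ y ∈ K, φ x ≤ φ y + ∑ r, μ r * a r y := by
  classical
  -- Strict inequalities make `Q` open, so the open-set form of Hahn–Banach applies; optimality of
  -- `x` means that 0 lies outside `Q`.
  let Q : Set ((ι → ℝ) × ℝ) := {q | ∃ y ∈ K, (∀ r, a r y < q.1 r) ∧ φ y - φ x < q.2}
  have hQo : IsOpen Q := by
    have : Q = ⋃ y ∈ K, ((⋂ r, {q : (ι → ℝ) × ℝ | a r y < q.1 r}) ∩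
        {q : (ι → ℝ) × ℝ | φ y - φ x < q.2}) := by
      ext q
      simp only [Q, Set.mem_iUnion, Set.mem_inter_iff, Set.mem_iInter, exists_prop]
      rfl
    rw [this]
    refine isOpen_biUnion fun y _ => IsOpen.inter ?_ ?_
    · exact isOpen_iInter_of_finite fun r => isOpen_lt continuous_const (by fun_prop)
    · exact isOpen_lt continuous_const (by fun_prop)
  have hQc : Convex ℝ Q := by
    rintro ⟨u, s⟩ ⟨y, hy, h1, h2⟩ ⟨u', s'⟩ ⟨y', hy', h1', h2'⟩ p q hp hq hpq
    refine ⟨p • y + q • y', hφ.1 hy hy' hp hq hpq, fun r => ?_, ?_⟩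
    · have h3 := (ha r).2 hy hy' hp hq hpq
      simp only [smul_eq_mul, Prod.fst_add, Prod.smul_fst, Pi.add_apply, Pi.smul_apply] at h3 ⊢
      have h4 := h1 r
      have h5 := h1' r
      simp only at h4 h5
      refine lt_of_le_of_lt h3 ?_
      rcases hp.eq_or_lt with rfl | hp'
      · have : q = 1 := by linarith
        subst this; linarith
      · nlinarith [mul_lt_mul_of_pos_left h4 hp', mul_le_mul_of_nonneg_left h5.le hq]
    · have h3 := hφ.2 hy hy' hp hq hpq
      simp only [smul_eq_mul, Prod.snd_add, Prod.smul_snd] at h3 h2 h2' ⊢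
      have h6 : p * (φ y - φ x) + q * (φ y' - φ x) = p * φ y + q * φ y' - φ x := by
        linear_combination (- φ x) * hpq
      rcases hp.eq_or_lt with rfl | hp'
      · have : q = 1 := by linarith
        subst this; linarith
      · nlinarith [mul_lt_mul_of_pos_left h2 hp', mul_le_mul_of_nonneg_left h2'.le hq]
  have hQ0 : (0 : (ι → ℝ) × ℝ) ∉ Q := by
    rintro ⟨y, hy, h1, h2⟩
    have := hmin y hy fun r => (h1 r).le
    simp only [Prod.snd_zero] at h2
    linarith
  obtain ⟨F, hF⟩ := geometric_hahn_banach_open_point hQc hQo hQ0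
  rw [map_zero] at hF
  set μ : ι → ℝ := fun r => - F (Pi.single r 1, 0) with hμ
  set θ : ℝ := - F (0, 1) with hθ
  have hFrep : ∀ u s, F (u, s) = - (∑ r, μ r * u r + θ * s) := by
    intro u s
    have h1 : ((u, s) : (ι → ℝ) × ℝ) = ∑ r, u r • ((Pi.single r 1, 0) : (ι → ℝ) × ℝ)
        + s • ((0, 1) : (ι → ℝ) × ℝ) := by
      refine Prod.ext ?_ ?_
      · ext j
        simp [Prod.fst_sum, Finset.sum_apply, Pi.single_apply]
      · simp [Prod.snd_sum]
    rw [h1, map_add, map_sum]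
    simp only [map_smul, smul_eq_mul, hμ, hθ, neg_mul, Finset.sum_neg_distrib]
    rw [Finset.sum_congr rfl fun r _ => mul_comm (u r) _]
    ring
  have hpos : ∀ y ∈ K, ∀ u : ι → ℝ, ∀ s, (∀ r, a r y < u r) → φ y - φ x < s →
      0 < ∑ r, μ r * u r + θ * s := by
    intro y hy u s h1 h2
    have := hF (u, s) ⟨y, hy, h1, h2⟩
    rw [hFrep] at this
    linarith
  -- The actual values lie on the boundary of `Q`: shift all coordinates by `t` and let `t` tend to
  -- 0.
  have hbase : ∀ y ∈ K, 0 ≤ ∑ r, μ r * a r y + θ * (φ y - φ x) := by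
    intro y hy
    refine le_of_forall_le_add_mul (C := |∑ r, μ r + θ|) (abs_nonneg _) fun t ht _ => ?_
    have h1 := hpos y hy (fun r => a r y + t) (φ y - φ x + t) (fun r => by linarith) (by linarith)
    have h2 : ∑ r, μ r * (a r y + t) + θ * (φ y - φ x + t)
        = ∑ r, μ r * a r y + θ * (φ y - φ x) + t * (∑ r, μ r + θ) := by
      simp only [mul_add, Finset.sum_add_distrib, ← Finset.sum_mul]
      ring
    rw [h2] at h1
    have h3 := mul_le_mul_of_nonneg_left (le_abs_self (∑ r, μ r + θ)) ht.le
    linarith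
  obtain ⟨y₀, hy₀, hneg⟩ := hslater
  -- `Q` is closed under increasing any coordinate, so the functional stays positive along these
  -- rays and no coefficient is negative.
  have hscale : ∀ {p q : ℝ}, (∀ t : ℝ, 0 < t → 0 < p + t * q) → 0 ≤ q := by
    intro p q h
    by_contra! hq
    have h1 := h ((|p| + 1) / (-q)) (div_pos (by positivity) (by linarith))
    have h2 : (|p| + 1) / (-q) * q = - (|p| + 1) := by
      rw [div_neg, neg_mul, div_mul_cancel₀ _ hq.ne]
    rw [h2] at h1
    linarith [le_abs_self p]
  have hμ0 : ∀ r, 0 ≤ μ r := by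
    intro r
    refine hscale (p := ∑ j, μ j * (a j y₀ + 1) + θ * (φ y₀ - φ x + 1)) fun t ht => ?_
    have h1 := hpos y₀ hy₀ (fun j => a j y₀ + 1 + t * (if j = r then 1 else 0)) (φ y₀ - φ x + 1)
      (fun j => by split_ifs <;> linarith) (by linarith)
    simp only [mul_add, Finset.sum_add_distrib, mul_ite, mul_one, mul_zero, Finset.sum_ite_eq',
      Finset.mem_univ, if_true] at h1 ⊢
    linarith
  have hθ0 : 0 ≤ θ := by
    refine hscale (p := ∑ j, μ j * (a j y₀ + 1) + θ * (φ y₀ - φ x + 1)) fun t ht => ?_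
    have h1 := hpos y₀ hy₀ (fun j => a j y₀ + 1) (φ y₀ - φ x + 1 + t)
      (fun j => by linarith) (by linarith)
    linarith
  -- If `θ = 0`, then `hbase` at the Slater point forces every `μ r` to vanish, against strict
  -- positivity on `Q`.
  have hθpos : 0 < θ := by
    refine lt_of_le_of_ne hθ0 fun h0 => ?_
    have h1 := hbase y₀ hy₀
    rw [← h0, zero_mul, add_zero] at h1
    have h2 : ∀ r ∈ Finset.univ, μ r * a r y₀ ≤ 0 := fun r _ =>
      mul_nonpos_of_nonneg_of_nonpos (hμ0 r) (hneg r).le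
    have h3 := (Finset.sum_eq_zero_iff_of_nonpos h2).1 (le_antisymm (Finset.sum_nonpos h2) h1)
    have h4 : ∀ r, μ r = 0 := fun r => by
      rcases mul_eq_zero.1 (h3 r (Finset.mem_univ r)) with h | h
      · exact h
      · exact absurd h (hneg r).ne
    have h5 := hpos y₀ hy₀ (fun j => a j y₀ + 1) (φ y₀ - φ x + 1)
      (fun j => by linarith) (by linarith)
    simp [h4, ← h0] at h5
  have hfinal : ∀ y ∈ K, φ x ≤ φ y + ∑ r, μ r / θ * a r y := by
    intro y hy
    have h1 := hbase y hy
    have h2 : ∑ r, μ r / θ * a r y = (∑ r, μ r * a r y) / θ := by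
      rw [Finset.sum_div]
      exact Finset.sum_congr rfl fun r _ => by ring
    rw [h2]
    have h3 : 0 ≤ (∑ r, μ r * a r y + θ * (φ y - φ x)) / θ := div_nonneg h1 hθ0
    rw [add_div, mul_div_cancel_left₀ _ hθpos.ne'] at h3
    linarith
  refine ⟨fun r => μ r / θ, fun r => div_nonneg (hμ0 r) hθ0, le_antisymm ?_ ?_, hfinal⟩
  · exact Finset.sum_nonpos fun r _ =>
      mul_nonpos_of_nonneg_of_nonpos (div_nonneg (hμ0 r) hθ0) (hxa r)
  · have := hfinal x hx
    linarith

/-! ### KKT points; existence and uniqueness of the equilibrium. -/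

namespace Game

variable {N m : ℕ} {n : Fin N → ℕ} {Ξ : Fin N → Type*} [∀ i, MeasurableSpace (Ξ i)]
  {𝒢 : Game m n Ξ} {D : ∀ i, Set (EuclideanSpace ℝ (Fin (n i)))}

theorem mulA_add (i : Fin N) (x y : EuclideanSpace ℝ (Fin (n i))) :
    𝒢.mulA i (x + y) = 𝒢.mulA i x + 𝒢.mulA i y := by
  simp [mulA, Matrix.mulVec_add]

theorem mulA_sub (i : Fin N) (x y : EuclideanSpace ℝ (Fin (n i))) :
    𝒢.mulA i (x - y) = 𝒢.mulA i x - 𝒢.mulA i y := by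
  simp [mulA, Matrix.mulVec_sub]

theorem mulA_smul (i : Fin N) (t : ℝ) (x : EuclideanSpace ℝ (Fin (n i))) :
    𝒢.mulA i (t • x) = t • 𝒢.mulA i x := by
  simp [mulA, Matrix.mulVec_smul]

theorem mulAT_sub (i : Fin N) (x y : Fin m → ℝ) :
    𝒢.mulAT i (x - y) = 𝒢.mulAT i x - 𝒢.mulAT i y := by
  simp [mulAT, Matrix.mulVec_sub]

theorem continuous_mulA (i : Fin N) : Continuous (𝒢.mulA i) := by
  unfold mulA
  exact Continuous.matrix_mulVec continuous_const (PiLp.continuous_ofLp 2 _)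

theorem continuous_mulAT (i : Fin N) : Continuous (𝒢.mulAT i) := by
  unfold mulAT
  exact (PiLp.continuous_toLp 2 _).comp (Continuous.matrix_mulVec continuous_const continuous_id)

theorem inner_mulAT (i : Fin N) (l : Fin m → ℝ) (y : EuclideanSpace ℝ (Fin (n i))) :
    ⟪𝒢.mulAT i l, y⟫ = l ⬝ᵥ 𝒢.mulA i y := by
  rw [EuclideanSpace.inner_eq_star_dotProduct, mulAT, mulA, Matrix.dotProduct_mulVec,
    ← Matrix.mulVec_transpose, dotProduct_comm]
  simp

theorem ExtLipschitz.sum_sq_le {ℓ : ℝ} (h : 𝒢.ExtLipschitz D ℓ) {X Y : Fin N → Dec n}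
    (hX : ∀ i j, X i j ∈ D j) (hY : ∀ i j, Y i j ∈ D j) :
    ∑ i, ‖𝒢.F i (X i) - 𝒢.F i (Y i)‖ ^ 2 ≤ ℓ ^ 2 * ∑ i, ∑ j, ‖X i j - Y i j‖ ^ 2 := by
  have h1 := pow_le_pow_left₀ (Real.sqrt_nonneg _) (h X Y hX hY) 2
  rwa [mul_pow, Real.sq_sqrt (by positivity), Real.sq_sqrt (by positivity)] at h1

/-- Karush–Kuhn–Tucker conditions for the variational inequality, with a common multiplier. -/
def IsKKT (𝒢 : Game m n Ξ) (x : Dec n) (l : Fin m → ℝ) : Prop :=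
  x ∈ 𝒢.feasible ∧ 0 ≤ l ∧ l ⬝ᵥ (∑ i, 𝒢.mulA i (x i) - ∑ i, 𝒢.b i) = 0 ∧
    ∀ i, - 𝒢.F i x - 𝒢.mulAT i l ∈ 𝒢.subdiff i (x i)

/-- Collective decisions with the Euclidean norm of the stacked vector. -/
abbrev EDec {N : ℕ} (n : Fin N → ℕ) : Type := PiLp 2 (fun i => EuclideanSpace ℝ (Fin (n i)))

/-- The argument moves to `EDec`, because the abstract existence result needs an inner product on
stacked vectors. -/
theorem exists_feasible_variational (h𝒢 : 𝒢.Regular D) {η ℓ : ℝ} (hη : 0 < η) (hℓ : 0 < ℓ)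
    (hmono : 𝒢.StronglyMonotone D η) (hlip : 𝒢.Lipschitz D ℓ) :
    ∃ x ∈ 𝒢.feasible, ∀ y ∈ 𝒢.feasible,
      ∑ i, 𝒢.g i (x i) ≤ ∑ i, 𝒢.g i (y i) + ∑ i, ⟪𝒢.F i x, y i - x i⟫ := by
  let K : Set (EDec n) := {x | WithLp.ofLp x ∈ 𝒢.feasible}
  have hKimg : K = (WithLp.toLp 2) '' (Set.univ.pi 𝒢.Ω ∩
      {x : Dec n | ∑ i, 𝒢.mulA i (x i) ≤ ∑ i, 𝒢.b i}) := by
    ext x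
    constructor
    · intro hx
      exact ⟨WithLp.ofLp x, ⟨fun i _ => hx.1 i, hx.2⟩, rfl⟩
    · rintro ⟨y, hy, rfl⟩
      exact ⟨fun i => hy.1 i trivial, hy.2⟩
  have hK : IsCompact K := by
    rw [hKimg]
    refine IsCompact.image ((isCompact_univ_pi h𝒢.compact).inter_right ?_)
      (PiLp.continuous_toLp 2 _)
    refine isClosed_le ?_ continuous_const
    exact continuous_finsetSum _ fun i _ => (continuous_mulA i).comp (continuous_apply i)
  have hmulA : ∀ (x y : EDec n) (p q : ℝ), ∑ i, 𝒢.mulA i ((p • x + q • y) i)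
      = p • ∑ i, 𝒢.mulA i (x i) + q • ∑ i, 𝒢.mulA i (y i) := by
    intro x y p q
    simp only [PiLp.add_apply, PiLp.smul_apply, mulA_add, mulA_smul, Finset.sum_add_distrib,
      Finset.smul_sum]
  have hKc : Convex ℝ K := by
    intro x hx y hy p q hp hq hpq
    refine ⟨fun i => h𝒢.convex i (hx.1 i) (hy.1 i) hp hq hpq, ?_⟩
    have := hmulA x y p q
    rw [this]
    calc p • ∑ i, 𝒢.mulA i (x i) + q • ∑ i, 𝒢.mulA i (y i)
        ≤ p • ∑ i, 𝒢.b i + q • ∑ i, 𝒢.b i :=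
          add_le_add (smul_le_smul_of_nonneg_left hx.2 hp) (smul_le_smul_of_nonneg_left hy.2 hq)
      _ = ∑ i, 𝒢.b i := by rw [← add_smul, hpq, one_smul]
  have hne : K.Nonempty := by
    obtain ⟨x, hx, hx'⟩ := h𝒢.slater
    exact ⟨WithLp.toLp 2 x, hx, fun r => (hx' r).le⟩
  have hφ : ConvexOn ℝ K (fun x : EDec n => ∑ i, 𝒢.g i (x i)) := by
    refine ⟨hKc, fun x hx y hy p q hp hq hpq => ?_⟩
    simp only [smul_eq_mul, Finset.mul_sum, ← Finset.sum_add_distrib]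
    exact Finset.sum_le_sum fun i _ => (h𝒢.g_convex i).2 (hx.1 i) (hy.1 i) hp hq hpq
  have hlsc : LowerSemicontinuousOn (fun x : EDec n => ∑ i, 𝒢.g i (x i)) K := by
    refine lowerSemicontinuousOn_sum fun i _ => ?_
    exact (h𝒢.g_lsc i).comp (PiLp.continuous_apply 2 _ i).continuousOn fun x hx => hx.1 i
  have hD : ∀ x ∈ K, ∀ j, x j ∈ D j := fun x hx j => h𝒢.subset_dom j (hx.1 j)
  obtain ⟨x, hx, hsol⟩ := exists_variational_solution (φ := fun x : EDec n => ∑ i, 𝒢.g i (x i))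
    (T := fun x : EDec n => (WithLp.toLp 2 (fun i => 𝒢.F i (WithLp.ofLp x)) : EDec n)) hne hK hφ hlsc hη hℓ
    (by
      intro x hx y hy
      have := hmono x y (hD x hx) (hD y hy)
      rw [PiLp.norm_sq_eq_of_L2, PiLp.inner_apply]
      simpa using this)
    (by
      intro x hx y hy
      have := hlip x y (hD x hx) (hD y hy)
      rw [PiLp.norm_eq_of_L2, PiLp.norm_eq_of_L2]
      simpa using this)
  refine ⟨WithLp.ofLp x, hx, fun y hy => ?_⟩
  have := hsol (WithLp.toLp 2 y) hy
  rw [PiLp.inner_apply] at this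
  simpa using this

/-- The variational solution minimizes the convex function `y ↦ ∑ g_i(y_i) + ⟪F_i(x), y_i - x_i⟫`
over the feasible set. Once the shared constraint is dualized, only the product of the `Ω i`
remains, so the Lagrangian inequality can be tested one block at a time; this gives the inclusion
for each agent. -/
theorem exists_isKKT (h𝒢 : 𝒢.Regular D) {η ℓ : ℝ} (hη : 0 < η) (hℓ : 0 < ℓ)
    (hmono : 𝒢.StronglyMonotone D η) (hlip : 𝒢.Lipschitz D ℓ) : ∃ x l, 𝒢.IsKKT x l := by
  obtain ⟨x, hx, hsol⟩ := exists_feasible_variational h𝒢 hη hℓ hmono hlip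
  have hΩ : Convex ℝ (Set.univ.pi 𝒢.Ω) := convex_pi fun i _ => h𝒢.convex i
  obtain ⟨l, hl, hcs, hlag⟩ := exists_multiplier (K := Set.univ.pi 𝒢.Ω)
    (φ := fun y : Dec n => ∑ i, (𝒢.g i (y i) + ⟪𝒢.F i x, y i - x i⟫))
    (a := fun r y => (∑ i, 𝒢.mulA i (y i) - ∑ i, 𝒢.b i) r) (x := x)
    (by
      refine ⟨hΩ, fun u hu v hv p q hp hq hpq => ?_⟩
      simp only [smul_eq_mul, Finset.mul_sum, ← Finset.sum_add_distrib]
      refine Finset.sum_le_sum fun i _ => ?_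
      have h1 := (h𝒢.g_convex i).2 (hu i trivial) (hv i trivial) hp hq hpq
      simp only [smul_eq_mul, Pi.add_apply, Pi.smul_apply] at h1 ⊢
      have h2 : p • u i + q • v i - x i = p • (u i - x i) + q • (v i - x i) := by
        have : x i = (p + q) • x i := by rw [hpq, one_smul]
        nth_rewrite 1 [this]
        module
      rw [h2, inner_add_right, inner_smul_right, inner_smul_right]
      linarith)
    (by
      intro r
      refine ⟨hΩ, fun u hu v hv p q hp hq hpq => le_of_eq ?_⟩
      have h3 : ∑ i, 𝒢.mulA i ((p • u + q • v) i) =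
          p • ∑ i, 𝒢.mulA i (u i) + q • ∑ i, 𝒢.mulA i (v i) := by
        simp only [Pi.add_apply, Pi.smul_apply, mulA_add, mulA_smul, Finset.sum_add_distrib,
          Finset.smul_sum]
      beta_reduce
      rw [h3]
      simp only [Pi.sub_apply, Pi.add_apply, Pi.smul_apply, smul_eq_mul]
      linear_combination ((∑ i, 𝒢.b i) r) * hpq)
    (by
      obtain ⟨y, hy, hy'⟩ := h𝒢.slater
      exact ⟨y, fun i _ => hy i, fun r => by simpa using hy' r⟩)
    (fun i _ => hx.1 i)
    (fun r => by simpa using hx.2 r)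
    (by
      intro y hy hyr
      have := hsol y ⟨fun i => hy i trivial, fun r => by simpa using hyr r⟩
      simpa [Finset.sum_add_distrib] using this)
  refine ⟨x, l, hx, hl, hcs, fun i => ⟨hx.1 i, fun y hy => ?_⟩⟩
  have h1 := hlag (Function.update x i y) (fun j _ => by
    rcases eq_or_ne j i with rfl | hj
    · simpa using hy
    · simpa [hj] using hx.1 j)
  have h2 : ∑ r, l r * (∑ j, 𝒢.mulA j (Function.update x i y j) - ∑ j, 𝒢.b j) r =
      ⟪𝒢.mulAT i l, y - x i⟫ := by
    have e : ∑ j, 𝒢.mulA j (Function.update x i y j) - ∑ j, 𝒢.b j =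
        𝒢.mulA i (y - x i) + (∑ j, 𝒢.mulA j (x j) - ∑ j, 𝒢.b j) := by
      rw [← Finset.add_sum_erase _ _ (Finset.mem_univ i),
        ← Finset.add_sum_erase _ (fun j => 𝒢.mulA j (x j)) (Finset.mem_univ i), mulA_sub]
      have : ∑ j ∈ Finset.univ.erase i, 𝒢.mulA j (Function.update x i y j) =
          ∑ j ∈ Finset.univ.erase i, 𝒢.mulA j (x j) :=
        Finset.sum_congr rfl fun j hj => by simp [Finset.ne_of_mem_erase hj]
      rw [this, Function.update_self]
      abel
    change l ⬝ᵥ _ = _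
    have hcs' : l ⬝ᵥ (∑ j, 𝒢.mulA j (x j) - ∑ j, 𝒢.b j) = 0 := hcs
    rw [e, dotProduct_add, hcs', add_zero, inner_mulAT]
  rw [h2, ← Finset.add_sum_erase _ _ (Finset.mem_univ i),
    ← Finset.add_sum_erase _ (fun j => 𝒢.g j (Function.update x i y j) + _)
      (Finset.mem_univ i)] at h1
  have h3 : ∑ j ∈ Finset.univ.erase i, (𝒢.g j (Function.update x i y j) +
      ⟪𝒢.F j x, Function.update x i y j - x j⟫) =
      ∑ j ∈ Finset.univ.erase i, (𝒢.g j (x j) + ⟪𝒢.F j x, x j - x j⟫) :=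
    Finset.sum_congr rfl fun j hj => by simp [Finset.ne_of_mem_erase hj]
  rw [h3, Function.update_self] at h1
  simp only [sub_self, inner_zero_right, add_zero] at h1
  rw [inner_sub_left, inner_neg_left]
  linarith

/-- With the subgradients `-F_i - A_iᵀ l`, complementary slackness reduces the sum to `l · (b - A
y)`. -/
theorem IsKKT.solvesSVI {x : Dec n} {l : Fin m → ℝ} (h : 𝒢.IsKKT x l) : 𝒢.SolvesSVI x := by
  obtain ⟨hx, hl, hcs, hsub⟩ := h
  refine ⟨hx, _, hsub, fun y hy => ?_⟩
  have h1 : ∑ i, ⟪𝒢.F i x + (- 𝒢.F i x - 𝒢.mulAT i l), y i - x i⟫ =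
      l ⬝ᵥ (∑ i, 𝒢.mulA i (x i) - ∑ i, 𝒢.b i) + l ⬝ᵥ (∑ i, 𝒢.b i - ∑ i, 𝒢.mulA i (y i)) := by
    rw [← dotProduct_add, sub_add_sub_cancel, ← Finset.sum_sub_distrib, dotProduct_sum]
    refine Finset.sum_congr rfl fun i _ => ?_
    rw [← mulA_sub, ← inner_mulAT, add_sub, add_neg_cancel, zero_sub, inner_neg_left,
      ← inner_neg_right, neg_sub]
  rw [h1, hcs, zero_add]
  exact dotProduct_nonneg_of_nonneg hl (sub_nonneg.2 hy.2)

/-- The first-order convexity inequality holds for each sample and is then integrated, so no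
differentiation under the integral occurs. Convexity is known only on `Ω i`, hence the one-sided
slope along the segment to `y`. -/
theorem Regular.inner_F_le (h𝒢 : 𝒢.Regular D) {x : Dec n} (hx : ∀ j, x j ∈ 𝒢.Ω j) (i : Fin N)
    {y : EuclideanSpace ℝ (Fin (n i))} (hy : y ∈ 𝒢.Ω i) :
    ∫ ξ, 𝒢.f i x (ξ i) ∂𝒢.P + ⟪𝒢.F i x, y - x i⟫ ≤
      ∫ ξ, 𝒢.f i (Function.update x i y) (ξ i) ∂𝒢.P := by
  have hxD : ∀ j, x j ∈ D j := fun j => h𝒢.subset_dom j (hx j)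
  have hg := h𝒢.grad_integrable i x hxD
  have h1 : ⟪𝒢.F i x, y - x i⟫ = ∫ ξ, ⟪𝒢.grad i x (ξ i), y - x i⟫ ∂𝒢.P := by
    rw [F, real_inner_comm, ← integral_inner hg]
    exact integral_congr_ae (.of_forall fun ξ => real_inner_comm _ _)
  rw [h1, ← integral_add (h𝒢.f_integrable i x hx) (hg.inner_const _)]
  refine integral_mono ((h𝒢.f_integrable i x hx).add (hg.inner_const _))
    (h𝒢.f_integrable i _ fun j => ?_) fun ξ => ?_
  · rcases eq_or_ne j i with rfl | hj
    · simpa using hy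
    · simpa [hj] using hx j
  · set φ : EuclideanSpace ℝ (Fin (n i)) → ℝ := fun y => 𝒢.f i (Function.update x i y) (ξ i)
      with hφdef
    have hconv : ConvexOn ℝ (𝒢.Ω i) φ := h𝒢.f_convex i x hx (ξ i)
    have hdiff : Differentiable ℝ φ := (h𝒢.f_smooth i x hxD (ξ i)).differentiable one_ne_zero
    have hgrad : HasGradientAt φ (𝒢.grad i x (ξ i)) (x i) := (hdiff (x i)).hasGradientAt
    have hφx : φ (x i) = 𝒢.f i x (ξ i) := by simp [hφdef]
    change 𝒢.f i x (ξ i) + ⟪𝒢.grad i x (ξ i), y - x i⟫ ≤ φ y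
    rw [← hφx]
    have hline : HasDerivAt (fun t : ℝ => φ (x i + t • (y - x i)))
        ⟪𝒢.grad i x (ξ i), y - x i⟫ 0 := by
      have h2 : HasDerivAt (fun t : ℝ => x i + t • (y - x i)) (y - x i) 0 := by
        simpa using ((hasDerivAt_id (0 : ℝ)).smul_const (y - x i)).const_add (x i)
      have h3 : HasFDerivAt φ (InnerProductSpace.toDual ℝ _ (𝒢.grad i x (ξ i)))
          (x i + (0 : ℝ) • (y - x i)) := by
        simpa using hgrad.hasFDerivAt
      have := h3.comp_hasDerivAt (0 : ℝ) h2
      simpa [Function.comp_def] using this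
    have hslope := hline.tendsto_slope_zero_right
    refine le_sub_iff_add_le'.1 (le_of_tendsto hslope ?_)
    have : Set.Ioc (0 : ℝ) 1 ∈ 𝓝[>] (0 : ℝ) := Ioc_mem_nhdsGT one_pos
    filter_upwards [this] with t ht
    have h4 := hconv.2 (hx i) hy (by linarith [ht.2] : (0 : ℝ) ≤ 1 - t) ht.1.le (by ring)
    have e : (1 - t) • x i + t • y = x i + t • (y - x i) := by module
    rw [e] at h4
    simp only [zero_add, zero_smul, add_zero, smul_eq_mul] at h4 ⊢
    rw [inv_mul_le_iff₀ ht.1]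
    linarith

/-- A locally feasible deviation of one agent is collectively feasible, so the variational
inequality can be tested at it; the gradient and subgradient inequalities then compare the costs. -/
theorem IsKKT.isVSGNE (h𝒢 : 𝒢.Regular D) {x : Dec n} {l : Fin m → ℝ} (h : 𝒢.IsKKT x l) :
    𝒢.IsVSGNE x := by
  refine ⟨⟨h.1, fun i y hy => ?_⟩, h.solvesSVI⟩
  obtain ⟨hx, v, hv, hsol⟩ := h.solvesSVI
  have hfeas : Function.update x i y ∈ 𝒢.feasible := by
    refine ⟨fun j => ?_, ?_⟩
    · rcases eq_or_ne j i with rfl | hj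
      · simpa using hy.1
      · simpa [hj] using hx.1 j
    · rw [← Finset.add_sum_erase _ _ (Finset.mem_univ i), Function.update_self]
      have e : ∑ j ∈ Finset.univ.erase i, 𝒢.mulA j (Function.update x i y j) =
          ∑ j ∈ Finset.univ.erase i, 𝒢.mulA j (x j) :=
        Finset.sum_congr rfl fun j hj => by simp [Finset.ne_of_mem_erase hj]
      rw [e]
      exact le_sub_iff_add_le.1 hy.2
  have h1 := hsol _ hfeas
  have h2 : ∑ j, ⟪𝒢.F j x + v j, Function.update x i y j - x j⟫ =
      ⟪𝒢.F i x + v i, y - x i⟫ := by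
    rw [Finset.sum_eq_single i]
    · simp
    · intro j _ hj
      simp [hj]
    · simp
  rw [h2, inner_add_left] at h1
  have h3 := h𝒢.inner_F_le hx.1 i hy.1
  have h4 := (hv i).2 y hy.1
  simp only [cost, Function.update_self]
  linarith

/-- Test each solution against the other and add: the subgradient terms have a favourable sign, and
strong monotonicity remains. -/
theorem SolvesSVI.unique (h𝒢 : 𝒢.Regular D) {η : ℝ} (hη : 0 < η) (hmono : 𝒢.StronglyMonotone D η)
    {x y : Dec n} (hx : 𝒢.SolvesSVI x) (hy : 𝒢.SolvesSVI y) : y = x := by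
  obtain ⟨hxf, v, hv, hxs⟩ := hx
  obtain ⟨hyf, w, hw, hys⟩ := hy
  have h1 := hmono x y (fun j => h𝒢.subset_dom j (hxf.1 j)) (fun j => h𝒢.subset_dom j (hyf.1 j))
  have h2 : 0 ≤ ∑ i, ⟪𝒢.F i x + v i, y i - x i⟫ + ∑ i, ⟪𝒢.F i y + w i, x i - y i⟫ :=
    add_nonneg (hxs y hyf) (hys x hxf)
  have h3 : ∑ i, ⟪𝒢.F i x + v i, y i - x i⟫ + ∑ i, ⟪𝒢.F i y + w i, x i - y i⟫ ≤
      - ∑ i, ⟪𝒢.F i x - 𝒢.F i y, x i - y i⟫ := by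
    rw [← Finset.sum_add_distrib, ← Finset.sum_neg_distrib]
    refine Finset.sum_le_sum fun i _ => ?_
    have h4 := (hv i).2 (y i) (hyf.1 i)
    have h5 := (hw i).2 (x i) (hxf.1 i)
    have h6 : ⟪𝒢.F i x + v i, y i - x i⟫ + ⟪𝒢.F i y + w i, x i - y i⟫ =
        - ⟪𝒢.F i x - 𝒢.F i y, x i - y i⟫ + (⟪v i, y i - x i⟫ + ⟪w i, x i - y i⟫) := by
      simp only [inner_add_left, inner_sub_left, inner_sub_right]
      ring
    rw [h6]
    linarith
  have h7 : ∑ i, ‖x i - y i‖ ^ 2 ≤ 0 := by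
    by_contra! hlt
    have := mul_pos hη hlt
    linarith
  have h8 := (Finset.sum_eq_zero_iff_of_nonneg fun i _ => by positivity).1
    (le_antisymm h7 (by positivity))
  funext i
  have := h8 i (Finset.mem_univ i)
  exact (sub_eq_zero.1 (norm_eq_zero.1 (pow_eq_zero_iff two_ne_zero |>.1 this))).symm

end Game

/-! ### Spectral properties of the weighted Laplacian. -/

section Laplacian

variable {N : ℕ} {G : SimpleGraph (Fin N)} {W : Matrix (Fin N) (Fin N) ℝ}

theorem laplacian_mulVec_apply (W : Matrix (Fin N) (Fin N) ℝ) (y : Fin N → ℝ) (i : Fin N) :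
    (laplacian W).mulVec y i = ∑ j, W i j * (y i - y j) := by
  rw [laplacian, Matrix.sub_mulVec, Pi.sub_apply, Matrix.mulVec_diagonal]
  simp [mul_sub, Finset.sum_mul, Matrix.mulVec, dotProduct]

theorem IsWeightMatrix.nonneg (hW : IsWeightMatrix G W) (i j : Fin N) : 0 ≤ W i j := by
  by_cases h : G.Adj i j
  · exact (hW.pos i j h).le
  · exact (hW.zero i j h).ge

theorem IsWeightMatrix.isHermitian (hW : IsWeightMatrix G W) : (laplacian W).IsHermitian := by
  refine Matrix.IsHermitian.sub (Matrix.isHermitian_diagonal _) ?_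
  ext i j
  simp [hW.symm i j]

theorem IsWeightMatrix.dotProduct_laplacian_comm (hW : IsWeightMatrix G W) (x y : Fin N → ℝ) :
    x ⬝ᵥ (laplacian W).mulVec y = (laplacian W).mulVec x ⬝ᵥ y := by
  have h : (laplacian W).transpose = laplacian W := by
    simpa using hW.isHermitian.eq
  rw [Matrix.dotProduct_mulVec, ← Matrix.mulVec_transpose, h]

theorem IsWeightMatrix.two_mul_dotProduct_laplacian (hW : IsWeightMatrix G W) (y : Fin N → ℝ) :
    2 * (y ⬝ᵥ (laplacian W).mulVec y) = ∑ i, ∑ j, W i j * (y i - y j) ^ 2 := by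
  have h1 : y ⬝ᵥ (laplacian W).mulVec y = ∑ i, ∑ j, W i j * ((y i - y j) * y i) := by
    simp only [dotProduct, laplacian_mulVec_apply, Finset.mul_sum]
    exact Finset.sum_congr rfl fun i _ => Finset.sum_congr rfl fun j _ => by ring
  have h2 : ∑ i, ∑ j, W i j * ((y i - y j) * y i) = ∑ i, ∑ j, W i j * ((y j - y i) * y j) := by
    rw [Finset.sum_comm]
    exact Finset.sum_congr rfl fun i _ => Finset.sum_congr rfl fun j _ => by rw [hW.symm j i]
  rw [two_mul]
  nth_rewrite 2 [h1]
  rw [h1, h2, ← h2]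
  nth_rewrite 2 [h2]
  simp only [← Finset.sum_add_distrib]
  exact Finset.sum_congr rfl fun i _ => Finset.sum_congr rfl fun j _ => by ring

theorem IsWeightMatrix.dotProduct_laplacian_nonneg (hW : IsWeightMatrix G W) (y : Fin N → ℝ) :
    0 ≤ y ⬝ᵥ (laplacian W).mulVec y := by
  have h1 := hW.two_mul_dotProduct_laplacian y
  have h2 : 0 ≤ ∑ i, ∑ j, W i j * (y i - y j) ^ 2 :=
    Finset.sum_nonneg fun i _ => Finset.sum_nonneg fun j _ =>
      mul_nonneg (hW.nonneg i j) (sq_nonneg _)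
  linarith

theorem IsWeightMatrix.eq_of_laplacian_eq_zero (hW : IsWeightMatrix G W) (hG : G.Connected)
    {y : Fin N → ℝ} (hy : (laplacian W).mulVec y = 0) (i j : Fin N) : y i = y j := by
  have h1 := hW.two_mul_dotProduct_laplacian y
  rw [hy, dotProduct_zero, mul_zero] at h1
  have hnn : ∀ i ∈ Finset.univ, 0 ≤ ∑ j, W i j * (y i - y j) ^ 2 := fun i _ =>
    Finset.sum_nonneg fun j _ => mul_nonneg (hW.nonneg i j) (sq_nonneg _)
  have hadj : ∀ a b, G.Adj a b → y a = y b := by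
    intro a b hab
    have h2 := (Finset.sum_eq_zero_iff_of_nonneg hnn).1 h1.symm a (Finset.mem_univ a)
    have h3 := (Finset.sum_eq_zero_iff_of_nonneg fun j _ =>
      mul_nonneg (hW.nonneg a j) (sq_nonneg _)).1 h2 b (Finset.mem_univ b)
    rcases mul_eq_zero.1 h3 with h | h
    · exact absurd h (hW.pos a b hab).ne'
    · exact sub_eq_zero.1 (pow_eq_zero_iff two_ne_zero |>.1 h)
  obtain ⟨p⟩ := hG.preconnected i j
  induction p with
  | nil => rfl
  | cons h _ ih => exact (hadj _ _ h).trans ih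

/-- Coercivity of the scaled Laplacian on the disagreement subspace. -/
theorem IsWeightMatrix.exists_coercive (hW : IsWeightMatrix G W) (hG : G.Connected) {c τ : ℝ}
    (hc : ∀ r : ℝ, Module.End.HasEigenvalue (Matrix.toLin' (laplacian W)) r → r ≠ 0 → τ < c * r) :
    ∃ τ', τ < τ' ∧ ∀ y : Fin N → ℝ, ∑ i, y i = 0 →
      τ' * ∑ i, y i ^ 2 ≤ c * (y ⬝ᵥ (laplacian W).mulVec y) := by
  classical
  have := hG.nonempty
  have hL := hW.isHermitian
  set e := hL.eigenvalues with he
  have heig : ∀ i, e i ≠ 0 → τ < c * e i := by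
    intro i hi
    refine hc _ ?_ hi
    refine Module.End.hasEigenvalue_of_hasEigenvector
      (x := WithLp.ofLp (hL.eigenvectorBasis i)) ⟨?_, ?_⟩
    · rw [Module.End.mem_eigenspace_iff, Matrix.toLin'_apply, hL.mulVec_eigenvectorBasis]
    · intro h0
      refine hL.eigenvectorBasis.orthonormal.ne_zero i ?_
      ext j
      simpa using congrFun h0 j
  refine ⟨Finset.univ.inf' Finset.univ_nonempty (fun i => if e i = 0 then τ + 1 else c * e i),
    ?_, fun y hy => ?_⟩
  · rw [Finset.lt_inf'_iff]
    intro i _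
    split_ifs with h
    · linarith
    · exact heig i h
  set τ' := Finset.univ.inf' Finset.univ_nonempty
    (fun i => if e i = 0 then τ + 1 else c * e i) with hτ'
  set u : Fin N → Fin N → ℝ := fun i => WithLp.ofLp (hL.eigenvectorBasis i) with hu
  have hinner : ∀ x : Fin N → ℝ, ∀ i, ⟪(WithLp.toLp 2 x : EuclideanSpace ℝ (Fin N)),
      hL.eigenvectorBasis i⟫ = x ⬝ᵥ u i := by
    intro x i
    rw [EuclideanSpace.inner_eq_star_dotProduct, dotProduct_comm]
    simp [hu]
  have hpars : ∀ x w : Fin N → ℝ, x ⬝ᵥ w = ∑ i, (x ⬝ᵥ u i) * (w ⬝ᵥ u i) := by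
    intro x w
    have h1 := hL.eigenvectorBasis.sum_inner_mul_inner (WithLp.toLp 2 x) (WithLp.toLp 2 w)
    have h2 : ⟪(WithLp.toLp 2 x : EuclideanSpace ℝ (Fin N)), WithLp.toLp 2 w⟫ = x ⬝ᵥ w := by
      rw [EuclideanSpace.inner_eq_star_dotProduct, dotProduct_comm]
      simp
    rw [← h2, ← h1]
    refine Finset.sum_congr rfl fun i _ => ?_
    rw [hinner, real_inner_comm, hinner]
  have hLu : ∀ i, (laplacian W).mulVec y ⬝ᵥ u i = e i * (y ⬝ᵥ u i) := by
    intro i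
    rw [← hW.dotProduct_laplacian_comm, hu, hL.mulVec_eigenvectorBasis, dotProduct_smul,
      smul_eq_mul]
  have h1 : y ⬝ᵥ (laplacian W).mulVec y = ∑ i, e i * (y ⬝ᵥ u i) ^ 2 := by
    rw [hpars]
    exact Finset.sum_congr rfl fun i _ => by rw [hLu]; ring
  have h2 : ∑ i, y i ^ 2 = ∑ i, (y ⬝ᵥ u i) ^ 2 := by
    have := hpars y y
    simp only [← sq] at this
    rw [← this]
    simp [dotProduct, sq]
  rw [h1, h2, Finset.mul_sum, Finset.mul_sum]
  refine Finset.sum_le_sum fun i _ => ?_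
  have h3 : τ' ≤ if e i = 0 then τ + 1 else c * e i :=
    Finset.inf'_le _ (Finset.mem_univ i)
  by_cases h0 : e i = 0
  -- By connectedness a kernel vector is constant, hence orthogonal to the zero-sum `y`.
  · have hconst := hW.eq_of_laplacian_eq_zero hG (y := u i) (by
      rw [hu, hL.mulVec_eigenvectorBasis, ← he, h0, zero_smul])
    have h4 : y ⬝ᵥ u i = 0 := by
      have : y ⬝ᵥ u i = ∑ j, y j * u i i :=
        Finset.sum_congr rfl fun j _ => by rw [hconst j i]
      rw [this, ← Finset.sum_mul, hy, zero_mul]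
    simp [h4, h0]
  · rw [if_neg h0] at h3
    have := mul_le_mul_of_nonneg_right h3 (sq_nonneg (y ⬝ᵥ u i))
    linarith

/-- No sign of `c` is assumed: coercivity at the difference of two adjacent basis vectors forces `c
> 0`. This makes consensus steps convex combinations. -/
theorem IsWeightMatrix.mul_weight_nonneg (hW : IsWeightMatrix G W) {c τ : ℝ} (hτ : 0 < τ)
    (hc : ∀ y : Fin N → ℝ, ∑ i, y i = 0 →
      τ * ∑ i, y i ^ 2 ≤ c * (y ⬝ᵥ (laplacian W).mulVec y)) (i j : Fin N) : 0 ≤ c * W i j := by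
  classical
  by_cases h : G.Adj i j
  · have h1 := hc (Pi.single i 1 - Pi.single j 1) (by simp)
    have h2 := hW.dotProduct_laplacian_nonneg (Pi.single i 1 - Pi.single j 1)
    have h3 : 0 < ∑ k, ((Pi.single i 1 - Pi.single j 1 : Fin N → ℝ) k) ^ 2 := by
      refine Finset.sum_pos' (fun k _ => sq_nonneg _) ⟨i, Finset.mem_univ i, ?_⟩
      simp [h.ne]
    have h4 : 0 < c * ((Pi.single i 1 - Pi.single j 1 : Fin N → ℝ) ⬝ᵥ
        (laplacian W).mulVec (Pi.single i 1 - Pi.single j 1)) := lt_of_lt_of_le (mul_pos hτ h3) h1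
    exact mul_nonneg (pos_of_mul_pos_left h4 h2).le (hW.nonneg i j)
  · simp [hW.zero i j h]

/-- Adding the summation map makes the Laplacian injective, hence bijective. Since the Laplacian has
zero-sum values, the preimage of a zero-sum vector has zero sum and the added map vanishes on it. -/
theorem IsWeightMatrix.exists_laplacian_eq (hW : IsWeightMatrix G W) (hG : G.Connected)
    {y : Fin N → ℝ} (hy : ∑ i, y i = 0) : ∃ z : Fin N → ℝ, (laplacian W).mulVec z = y := by
  have := hG.nonempty
  let T : (Fin N → ℝ) →ₗ[ℝ] (Fin N → ℝ) :=
    Matrix.toLin' (laplacian W) + LinearMap.pi fun _ => ∑ i, LinearMap.proj i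
  have hT : ∀ z, T z = (laplacian W).mulVec z + fun _ => ∑ i, z i := by
    intro z
    ext i
    simp [T, LinearMap.sum_apply]
  have hsum : ∀ z, ∑ i, (laplacian W).mulVec z i = 0 := by
    intro z
    have h1 := hW.dotProduct_laplacian_comm 1 z
    have h2 : (laplacian W).mulVec 1 = 0 := by
      ext i
      simp [laplacian_mulVec_apply]
    rw [h2, zero_dotProduct, one_dotProduct] at h1
    exact h1
  have hsumT : ∀ z, ∑ i, T z i = N * ∑ i, z i := by
    intro z
    simp [hT, Finset.sum_add_distrib, hsum]
  have hN : (N : ℝ) ≠ 0 := by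
    have : NeZero N := ⟨fun h => by subst h; exact (hG.nonempty.elim fun i => i.elim0)⟩
    exact Nat.cast_ne_zero.2 this.out
  have hinj : Function.Injective T := by
    refine (injective_iff_map_eq_zero T).2 fun z hz => ?_
    have h1 := hsumT z
    rw [hz] at h1
    have h2 : ∑ i, z i = 0 := by simpa [hN] using h1.symm
    have h3 := hT z
    rw [hz, h2] at h3
    have h4 : (laplacian W).mulVec z = 0 := by
      ext i
      have := congrFun h3 i
      simpa using this.symm
    ext i
    have h5 : ∑ j, z j = ∑ _j : Fin N, z i :=
      Finset.sum_congr rfl fun j _ => hW.eq_of_laplacian_eq_zero hG h4 j i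
    rw [h2] at h5
    simpa [hN] using h5.symm
  obtain ⟨z, hz⟩ := (LinearMap.injective_iff_surjective.1 hinj) y
  refine ⟨z, ?_⟩
  have h1 := hsumT z
  rw [hz, hy] at h1
  have h2 : ∑ i, z i = 0 := by simpa [hN] using h1.symm
  have h3 := hT z
  rw [hz, h2] at h3
  ext i
  have := congrFun h3 i
  simpa using this.symm

/-- The Laplacian acting on a family of vectors. -/
def lap {V : Type*} [AddCommGroup V] [Module ℝ V] (W : Matrix (Fin N) (Fin N) ℝ) (y : Fin N → V)
    (i : Fin N) : V := ∑ j, W i j • (y i - y j)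

theorem lap_sub {V : Type*} [AddCommGroup V] [Module ℝ V] (x y : Fin N → V) (i : Fin N) :
    lap W (x - y) i = lap W x i - lap W y i := by
  simp only [lap, ← Finset.sum_sub_distrib]
  exact Finset.sum_congr rfl fun j _ => by simp only [Pi.sub_apply]; module

theorem lap_const {V : Type*} [AddCommGroup V] [Module ℝ V] (v : V) (i : Fin N) :
    lap W (fun _ => v) i = 0 := by
  simp [lap]

theorem lap_apply {κ : Type*} (y : Fin N → κ → ℝ) (i : Fin N) (r : κ) :
    lap W y i r = (laplacian W).mulVec (fun j => y j r) i := by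
  simp [lap, laplacian_mulVec_apply]

theorem IsWeightMatrix.sum_lap_dotProduct (hW : IsWeightMatrix G W) {m : ℕ}
    (x y : Fin N → Fin m → ℝ) : ∑ i, lap W x i ⬝ᵥ y i = ∑ i, x i ⬝ᵥ lap W y i := by
  simp only [dotProduct, lap_apply]
  rw [Finset.sum_comm, Finset.sum_comm (s := Finset.univ (α := Fin N))]
  exact Finset.sum_congr rfl fun r _ =>
    (hW.dotProduct_laplacian_comm (fun j => x j r) (fun j => y j r)).symm

theorem IsWeightMatrix.exists_lap_eq (hW : IsWeightMatrix G W) (hG : G.Connected) {m : ℕ}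
    {y : Fin N → Fin m → ℝ} (hy : ∑ i, y i = 0) : ∃ z : Fin N → Fin m → ℝ, ∀ i, lap W z i = y i := by
  have h : ∀ r, ∃ z : Fin N → ℝ, (laplacian W).mulVec z = fun i => y i r := fun r =>
    hW.exists_laplacian_eq hG (by simpa using congrFun hy r)
  choose z hz using h
  refine ⟨fun i r => z r i, fun i => ?_⟩
  ext r
  rw [lap_apply]
  exact congrFun (hz r) i

theorem le_sum_inner_lap {c τ : ℝ}
    (hc : ∀ y : Fin N → ℝ, ∑ i, y i = 0 →
      τ * ∑ i, y i ^ 2 ≤ c * (y ⬝ᵥ (laplacian W).mulVec y)) {d : ℕ}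
    {y : Fin N → EuclideanSpace ℝ (Fin d)} (hy : ∑ i, y i = 0) :
    τ * ∑ i, ‖y i‖ ^ 2 ≤ c * ∑ i, ⟪lap W y i, y i⟫ := by
  have h1 : ∑ i, ‖y i‖ ^ 2 = ∑ r, ∑ i, y i r ^ 2 := by
    simp only [EuclideanSpace.real_norm_sq_eq]
    exact Finset.sum_comm
  have h2 : ∑ i, ⟪lap W y i, y i⟫ =
      ∑ r, (fun i => y i r) ⬝ᵥ (laplacian W).mulVec (fun i => y i r) := by
    simp only [PiLp.inner_apply, dotProduct]
    rw [Finset.sum_comm]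
    refine Finset.sum_congr rfl fun r _ => Finset.sum_congr rfl fun i _ => ?_
    simp [lap, laplacian_mulVec_apply]
  rw [h1, h2, Finset.mul_sum, Finset.mul_sum]
  refine Finset.sum_le_sum fun r _ => hc _ ?_
  have := congrArg (fun v => v r) hy
  simpa using this

end Laplacian

/-! ### Strong monotonicity relative to consensual points. -/

section Monotone

variable {N m : ℕ} {n : Fin N → ℕ} {Ξ : Fin N → Type*} [∀ i, MeasurableSpace (Ξ i)]
  {𝒢 : Game m n Ξ} {D : ∀ i, Set (EuclideanSpace ℝ (Fin (n i)))}
  {G : SimpleGraph (Fin N)} {W : Matrix (Fin N) (Fin N) ℝ}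

theorem exists_quadratic_lower_bound {η s d : ℝ} (hη : 0 < η) (hd : 0 < d) :
    ∃ θ, 0 < θ ∧ ∀ u y : ℝ,
      θ * u ^ 2 + d / 2 * y ^ 2 ≤ η * u ^ 2 - s * u * y + (s ^ 2 / (4 * η) + d) * y ^ 2 := by
  have hden : 0 < s ^ 2 + 2 * d * η := by positivity
  -- This `θ` solves 4(η - θ)(s²/(4η) + d/2) = s², so what is left of the form is a square up to a
  -- positive factor. For `s = 0` it equals `η`, whence the separate case.
  refine ⟨2 * η ^ 2 * d / (s ^ 2 + 2 * d * η), by positivity, fun u y => ?_⟩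
  set θ := 2 * η ^ 2 * d / (s ^ 2 + 2 * d * η) with hθ
  set q := s ^ 2 / (4 * η) + d / 2 with hq
  rcases eq_or_ne s 0 with rfl | hs
  · have h1 : θ = η := by rw [hθ]; field_simp; ring
    rw [h1]
    have : 0 ≤ d * y ^ 2 := by positivity
    have h2 : (0 : ℝ) ^ 2 / (4 * η) = 0 := by simp
    rw [h2]
    linarith
  have hθη : 0 < η - θ := by
    have : η - θ = η * s ^ 2 / (s ^ 2 + 2 * d * η) := by
      rw [hθ]; field_simp; ring
    rw [this]
    positivity
  have h1 : 4 * (η - θ) * q = s ^ 2 := by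
    rw [hθ, hq]; field_simp; ring
  have h2 : 0 ≤ 4 * (η - θ) * ((η - θ) * u ^ 2 - s * u * y + q * y ^ 2) := by
    have : 4 * (η - θ) * ((η - θ) * u ^ 2 - s * u * y + q * y ^ 2) =
        (2 * (η - θ) * u - s * y) ^ 2 := by
      linear_combination y ^ 2 * h1
    rw [this]
    positivity
  have h3 := nonneg_of_mul_nonneg_right h2 (by positivity)
  have h4 : s ^ 2 / (4 * η) + d = q + d / 2 := by rw [hq]; ring
  rw [h4]
  linarith

theorem neg_sqrt_mul_sqrt_le_sum_inner {ι : Type*} [Fintype ι] {V : ι → Type*}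
    [∀ i, NormedAddCommGroup (V i)] [∀ i, InnerProductSpace ℝ (V i)] (a b : ∀ i, V i) :
    - (√(∑ i, ‖a i‖ ^ 2) * √(∑ i, ‖b i‖ ^ 2)) ≤ ∑ i, ⟪a i, b i⟫ := by
  have h1 : - ∑ i, ‖a i‖ * ‖b i‖ ≤ ∑ i, ⟪a i, b i⟫ := by
    rw [← Finset.sum_neg_distrib]
    exact Finset.sum_le_sum fun i _ => neg_le_of_abs_le (abs_real_inner_le_norm _ _)
  have h2 := Real.sum_mul_le_sqrt_mul_sqrt Finset.univ (fun i => ‖a i‖) (fun i => ‖b i‖)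
  linarith

theorem sum_norm_add_sq_of_sum_eq_zero {V : Type*} [NormedAddCommGroup V] [InnerProductSpace ℝ V]
    {y : Fin N → V} (hy : ∑ i, y i = 0) (w : V) :
    ∑ i, ‖y i + w‖ ^ 2 = ∑ i, ‖y i‖ ^ 2 + N * ‖w‖ ^ 2 := by
  simp only [norm_add_sq_real, Finset.sum_add_distrib, ← Finset.mul_sum, ← sum_inner, hy,
    inner_zero_left]
  simp

theorem IsWeightMatrix.sum_lap (hW : IsWeightMatrix G W) {V : Type*} [AddCommGroup V] [Module ℝ V]
    (y : Fin N → V) : ∑ i, lap W y i = 0 := by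
  simp only [lap, smul_sub, Finset.sum_sub_distrib]
  rw [sub_eq_zero, Finset.sum_comm]
  exact Finset.sum_congr rfl fun i _ => Finset.sum_congr rfl fun j _ => by rw [hW.symm]

/-- The extended operator (pseudogradient plus consensus) is strongly monotone relative to
consensual points. -/
theorem exists_restricted_strong_monotonicity (hconv : ∀ i, Convex ℝ (D i)) {η ℓF ℓp c τ : ℝ}
    (hη : 0 < η) (hℓF : 0 < ℓF) (hℓp : 0 < ℓp) (hmono : 𝒢.StronglyMonotone D η)
    (hlip : 𝒢.Lipschitz D ℓF) (hext : 𝒢.ExtLipschitz D ℓp) (hG : G.Connected)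
    (hW : IsWeightMatrix G W) (hτ : (ℓp + ℓF) ^ 2 / (4 * η) + ℓp < τ)
    (hc : ∀ y : Fin N → ℝ, ∑ i, y i = 0 →
      τ * ∑ i, y i ^ 2 ≤ c * (y ⬝ᵥ (laplacian W).mulVec y)) :
    ∃ κ, 0 < κ ∧ ∀ (X : Fin N → Dec n) (xs : Dec n), (∀ i j, X i j ∈ D j) → (∀ j, xs j ∈ D j) →
      κ * ∑ i, ∑ j, ‖X i j - xs j‖ ^ 2 ≤ ∑ i, ⟪𝒢.F i (X i) - 𝒢.F i xs, X i i - xs i⟫ +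
        c * ∑ i, ∑ j, ⟪lap W (fun h => X h j) i, X i j - xs j⟫ := by
  have hN0 : N ≠ 0 := fun h => by subst h; exact hG.nonempty.elim fun i => i.elim0
  have hN : (0 : ℝ) < N := Nat.cast_pos.2 (Nat.pos_of_ne_zero hN0)
  obtain ⟨θ, hθ, hquad⟩ := exists_quadratic_lower_bound (s := ℓp + ℓF)
    (d := τ - ((ℓp + ℓF) ^ 2 / (4 * η) + ℓp)) hη (by linarith)
  set d := τ - ((ℓp + ℓF) ^ 2 / (4 * η) + ℓp) with hd
  have hdpos : 0 < d := by linarith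
  -- The squared distance is N u² + v², with `u` the distance of the average to `xs` and `v` the
  -- disagreement; hence the division by `N`.
  refine ⟨min (θ / N) (d / 2), lt_min (by positivity) (by positivity), fun X xs hX hxs => ?_⟩
  obtain ⟨xb, hxb⟩ : ∃ xb : Dec n, ∀ j, xb j = (N : ℝ)⁻¹ • ∑ i, X i j := ⟨_, fun _ => rfl⟩
  have hxbD : ∀ j, xb j ∈ D j := by
    intro j
    rw [hxb, Finset.smul_sum]
    refine (hconv j).sum_mem (fun i _ => by positivity) ?_ fun i _ => hX i j
    simp [hN.ne']
  obtain ⟨y, hy⟩ : ∃ y : Fin N → Dec n, ∀ i j, y i j = X i j - xb j := ⟨_, fun _ _ => rfl⟩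
  have hysum : ∀ j, ∑ i, y i j = 0 := by
    intro j
    simp only [hy, Finset.sum_sub_distrib, Finset.sum_const, Finset.card_univ, Fintype.card_fin,
      hxb, ← Nat.cast_smul_eq_nsmul ℝ, smul_smul, mul_inv_cancel₀ hN.ne', one_smul, sub_self]
  have hXy : ∀ i j, X i j - xs j = y i j + (xb j - xs j) := fun i j => by simp [hy]
  obtain ⟨u, hu⟩ : ∃ u, u = √(∑ j, ‖xb j - xs j‖ ^ 2) := ⟨_, rfl⟩
  obtain ⟨v, hv⟩ : ∃ v, v = √(∑ i, ∑ j, ‖y i j‖ ^ 2) := ⟨_, rfl⟩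
  have hu2 : u ^ 2 = ∑ j, ‖xb j - xs j‖ ^ 2 := by
    rw [hu, Real.sq_sqrt (Finset.sum_nonneg fun j _ => sq_nonneg _)]
  have hv2 : v ^ 2 = ∑ i, ∑ j, ‖y i j‖ ^ 2 := by
    rw [hv, Real.sq_sqrt (Finset.sum_nonneg fun i _ => Finset.sum_nonneg fun j _ => sq_nonneg _)]
  have hu0 : 0 ≤ u := hu ▸ Real.sqrt_nonneg _
  have hv0 : 0 ≤ v := hv ▸ Real.sqrt_nonneg _
  have hdist : ∑ i, ∑ j, ‖X i j - xs j‖ ^ 2 = N * u ^ 2 + v ^ 2 := by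
    have e1 : ∑ i, ∑ j, ‖X i j - xs j‖ ^ 2 = ∑ j, ∑ i, ‖X i j - xs j‖ ^ 2 := Finset.sum_comm
    have e2 : ∑ i, ∑ j, ‖y i j‖ ^ 2 = ∑ j, ∑ i, ‖y i j‖ ^ 2 := Finset.sum_comm
    rw [hu2, hv2, e1, e2, Finset.mul_sum, ← Finset.sum_add_distrib]
    refine Finset.sum_congr rfl fun j _ => ?_
    simp only [hXy]
    rw [sum_norm_add_sq_of_sum_eq_zero (hysum j), add_comm]
  have hlap : τ * v ^ 2 ≤ c * ∑ i, ∑ j, ⟪lap W (fun h => X h j) i, X i j - xs j⟫ := by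
    have e1 : ∑ i, ∑ j, ‖y i j‖ ^ 2 = ∑ j, ∑ i, ‖y i j‖ ^ 2 := Finset.sum_comm
    have e2 : ∑ i, ∑ j, ⟪lap W (fun h => X h j) i, X i j - xs j⟫ =
        ∑ j, ∑ i, ⟪lap W (fun h => X h j) i, X i j - xs j⟫ := Finset.sum_comm
    rw [hv2, e1, e2, Finset.mul_sum, Finset.mul_sum]
    refine Finset.sum_le_sum fun j _ => ?_
    have h1 : ∀ i, lap W (fun h => X h j) i = lap W (fun h => y h j) i := by
      intro i
      simp only [lap, hy]
      exact Finset.sum_congr rfl fun h _ => by rw [sub_sub_sub_cancel_right]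
    have h2 : ∑ i, ⟪lap W (fun h => X h j) i, X i j - xs j⟫ =
        ∑ i, ⟪lap W (fun h => y h j) i, y i j⟫ := by
      simp only [h1, hXy, inner_add_right, Finset.sum_add_distrib, ← sum_inner]
      rw [hW.sum_lap, inner_zero_left, add_zero]
    rw [h2]
    exact le_sum_inner_lap hc (hysum j)
  have hydiag : √(∑ i, ‖y i i‖ ^ 2) ≤ v := by
    rw [hv]
    refine Real.sqrt_le_sqrt (Finset.sum_le_sum fun i _ => ?_)
    exact Finset.single_le_sum (f := fun j => ‖y i j‖ ^ 2) (fun j _ => by positivity)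
      (Finset.mem_univ i)
  have hF1 := hmono xb xs hxbD hxs
  rw [← hu2] at hF1
  have hLF : √(∑ i, ‖𝒢.F i xb - 𝒢.F i xs‖ ^ 2) ≤ ℓF * u := hu ▸ hlip xb xs hxbD hxs
  have hLp : √(∑ i, ‖𝒢.F i (X i) - 𝒢.F i xb‖ ^ 2) ≤ ℓp * v := by
    have := hext X (fun _ => xb) hX fun _ => hxbD
    simp only [← hy] at this
    rwa [hv]
  have hF2 : - (ℓF * u * v) ≤ ∑ i, ⟪𝒢.F i xb - 𝒢.F i xs, y i i⟫ := by
    refine le_trans ?_ (neg_sqrt_mul_sqrt_le_sum_inner _ _)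
    exact neg_le_neg (mul_le_mul hLF hydiag (Real.sqrt_nonneg _) (by positivity))
  have hF3 : - (ℓp * v * u) ≤ ∑ i, ⟪𝒢.F i (X i) - 𝒢.F i xb, xb i - xs i⟫ := by
    refine le_trans ?_ (neg_sqrt_mul_sqrt_le_sum_inner _ _)
    rw [← hu]
    exact neg_le_neg (mul_le_mul hLp le_rfl hu0 (by positivity))
  have hF4 : - (ℓp * v * v) ≤ ∑ i, ⟪𝒢.F i (X i) - 𝒢.F i xb, y i i⟫ := by
    refine le_trans ?_ (neg_sqrt_mul_sqrt_le_sum_inner _ _)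
    exact neg_le_neg (mul_le_mul hLp hydiag (Real.sqrt_nonneg _) (by positivity))
  -- Splitting at the average leaves one strongly monotone term and cross terms of size ℓF u v, ℓp u
  -- v and ℓp v². With the Laplacian's τ v² the lower bound is η u² - (ℓp + ℓF) u v + (τ - ℓp) v².
  have hF : ∑ i, ⟪𝒢.F i (X i) - 𝒢.F i xs, X i i - xs i⟫ =
      ∑ i, ⟪𝒢.F i xb - 𝒢.F i xs, xb i - xs i⟫ + ∑ i, ⟪𝒢.F i xb - 𝒢.F i xs, y i i⟫ +
      ∑ i, ⟪𝒢.F i (X i) - 𝒢.F i xb, xb i - xs i⟫ +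
      ∑ i, ⟪𝒢.F i (X i) - 𝒢.F i xb, y i i⟫ := by
    simp only [← Finset.sum_add_distrib]
    refine Finset.sum_congr rfl fun i _ => ?_
    rw [hXy, inner_add_right]
    simp only [inner_sub_left]
    ring
  have hq := hquad u v
  have h1 : min (θ / N) (d / 2) * (N * u ^ 2 + v ^ 2) ≤ θ * u ^ 2 + d / 2 * v ^ 2 := by
    have h2 : min (θ / N) (d / 2) * (N * u ^ 2) ≤ θ / N * (N * u ^ 2) :=
      mul_le_mul_of_nonneg_right (min_le_left _ _) (by positivity)
    have h3 : min (θ / N) (d / 2) * v ^ 2 ≤ d / 2 * v ^ 2 :=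
      mul_le_mul_of_nonneg_right (min_le_right _ _) (by positivity)
    have h4 : θ / N * (N * u ^ 2) = θ * u ^ 2 := by field_simp
    linarith
  rw [hdist, hF]
  have h5 : ((ℓp + ℓF) ^ 2 / (4 * η) + d) * v ^ 2 = (τ - ℓp) * v ^ 2 := by rw [hd]; ring
  rw [h5] at hq
  nlinarith

end Monotone

/-! ### The preconditioned metric. -/

section Lyapunov

variable {N m : ℕ} {n : Fin N → ℕ} {Ξ : Fin N → Type*} [∀ i, MeasurableSpace (Ξ i)]
  {𝒢 : Game m n Ξ} {D : ∀ i, Set (EuclideanSpace ℝ (Fin (n i)))}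
  {G : SimpleGraph (Fin N)} {W : Matrix (Fin N) (Fin N) ℝ}

theorem lap_eq_sum_smul {V : Type*} [AddCommGroup V] [Module ℝ V] (y : Fin N → V) (i : Fin N) :
    lap W y i = ∑ j, laplacian W i j • y j := by
  simp [lap, laplacian, sub_smul, smul_sub, Matrix.diagonal_apply, ite_smul, Finset.sum_smul]

theorem sum_norm_lap_sq_le {V : Type*} [NormedAddCommGroup V] [NormedSpace ℝ V] (y : Fin N → V) :
    ∑ i, ‖lap W y i‖ ^ 2 ≤ (∑ i, ∑ j, laplacian W i j ^ 2) * ∑ j, ‖y j‖ ^ 2 := by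
  rw [Finset.sum_mul]
  refine Finset.sum_le_sum fun i _ => ?_
  rw [lap_eq_sum_smul]
  calc ‖∑ j, laplacian W i j • y j‖ ^ 2 ≤ (∑ j, |laplacian W i j| * ‖y j‖) ^ 2 := by
        refine pow_le_pow_left₀ (norm_nonneg _) ((norm_sum_le _ _).trans_eq ?_) 2
        simp [norm_smul]
    _ ≤ (∑ j, |laplacian W i j| ^ 2) * ∑ j, ‖y j‖ ^ 2 := Finset.sum_mul_sq_le_sq_mul_sq _ _ _
    _ = _ := by simp

theorem sum_lap_dotProduct_self_le (y : Fin N → Fin m → ℝ) :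
    ∑ i, lap W y i ⬝ᵥ lap W y i ≤ (∑ i, ∑ j, laplacian W i j ^ 2) * ∑ j, y j ⬝ᵥ y j := by
  have h : ∀ r, ∑ i, lap W y i r ^ 2 ≤ (∑ i, ∑ j, laplacian W i j ^ 2) * ∑ j, y j r ^ 2 := by
    intro r
    have h1 := sum_norm_lap_sq_le (W := W) (fun j => y j r)
    have h2 : ∀ i, lap W (fun j => y j r) i = lap W y i r := fun i => by simp [lap]
    simpa [h2] using h1
  simp only [dotProduct, ← sq]
  rw [Finset.sum_comm, Finset.sum_comm (f := fun j r => y j r ^ 2), Finset.mul_sum]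
  exact Finset.sum_le_sum fun r _ => h r

theorem Game.mulA_dotProduct_self_le (i : Fin N) (x : EuclideanSpace ℝ (Fin (n i))) :
    𝒢.mulA i x ⬝ᵥ 𝒢.mulA i x ≤ (∑ r, ∑ s, 𝒢.A i r s ^ 2) * ‖x‖ ^ 2 := by
  rw [Finset.sum_mul, EuclideanSpace.real_norm_sq_eq]
  simp only [dotProduct, ← sq, mulA, Matrix.mulVec]
  exact Finset.sum_le_sum fun r _ => Finset.sum_mul_sq_le_sq_mul_sq _ _ _

theorem abs_dotProduct_le (x y : Fin m → ℝ) : |x ⬝ᵥ y| ≤ (x ⬝ᵥ x + y ⬝ᵥ y) / 2 := by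
  rw [dotProduct, dotProduct, dotProduct, ← Finset.sum_add_distrib, Finset.sum_div]
  refine (Finset.abs_sum_le_sum_abs _ _).trans (Finset.sum_le_sum fun r _ => ?_)
  rw [abs_le]
  constructor <;> nlinarith [sq_nonneg (x r + y r), sq_nonneg (x r - y r)]

/-- The quadratic form of the preconditioner of the algorithm. -/
def precond (𝒢 : Game m n Ξ) (W : Matrix (Fin N) (Fin N) ℝ) (α ν δ : Fin N → ℝ)
    (X : Fin N → Dec n) (z l : Fin N → Fin m → ℝ) : ℝ :=
  ∑ i, ((2 * α i)⁻¹ * ∑ j, ‖X i j‖ ^ 2 + (2 * ν i)⁻¹ * (z i ⬝ᵥ z i) + (2 * δ i)⁻¹ * (l i ⬝ᵥ l i)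
    - l i ⬝ᵥ 𝒢.mulA i (X i i) + l i ⬝ᵥ lap W z i)

/-- Young's inequality bounds the off-diagonal terms by the diagonal ones when the inverse step
sizes are large. The margin `β` in the decision block will absorb the error of the forward step. -/
theorem exists_le_precond (𝒢 : Game m n Ξ) (W : Matrix (Fin N) (Fin N) ℝ) :
    ∃ Γ : ℝ, 0 ≤ Γ ∧ ∀ (β : ℝ) (α ν δ : Fin N → ℝ), 0 ≤ β → (∀ i, Γ + β ≤ (2 * α i)⁻¹) →
      (∀ i, Γ ≤ (2 * ν i)⁻¹) → (∀ i, Γ ≤ (2 * δ i)⁻¹) →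
      ∀ (X : Fin N → Dec n) (z l : Fin N → Fin m → ℝ),
        β * ∑ i, ∑ j, ‖X i j‖ ^ 2 ≤ precond 𝒢 W α ν δ X z l := by
  set ΓA := ∑ i, ∑ r, ∑ s, 𝒢.A i r s ^ 2 with hΓA
  set ΓL := ∑ i, ∑ j, laplacian W i j ^ 2 with hΓL
  have hA0 : 0 ≤ ΓA := by positivity
  have hL0 : 0 ≤ ΓL := by positivity
  refine ⟨ΓA + ΓL + 1, by positivity, fun β α ν δ hβ hα hν hδ X z l => ?_⟩
  have hlap : - ((∑ i, l i ⬝ᵥ l i + ΓL * ∑ i, z i ⬝ᵥ z i) / 2) ≤ ∑ i, l i ⬝ᵥ lap W z i := by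
    have h1 := sum_lap_dotProduct_self_le (W := W) z
    have h2 : - ((∑ i, l i ⬝ᵥ l i + ∑ i, lap W z i ⬝ᵥ lap W z i) / 2) ≤
        ∑ i, l i ⬝ᵥ lap W z i := by
      rw [← Finset.sum_add_distrib, Finset.sum_div, ← Finset.sum_neg_distrib]
      exact Finset.sum_le_sum fun i _ => neg_le_of_abs_le (abs_dotProduct_le _ _)
    linarith
  have hmul : - ((∑ i, l i ⬝ᵥ l i + ΓA * ∑ i, ∑ j, ‖X i j‖ ^ 2) / 2) ≤
      - ∑ i, l i ⬝ᵥ 𝒢.mulA i (X i i) := by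
    rw [Finset.mul_sum, ← Finset.sum_add_distrib, Finset.sum_div]
    refine neg_le_neg (Finset.sum_le_sum fun i _ => ?_)
    have h1 := 𝒢.mulA_dotProduct_self_le i (X i i)
    have h2 := le_of_abs_le (abs_dotProduct_le (l i) (𝒢.mulA i (X i i)))
    have h3 : (∑ r, ∑ s, 𝒢.A i r s ^ 2) ≤ ΓA :=
      Finset.single_le_sum (f := fun i => ∑ r, ∑ s, 𝒢.A i r s ^ 2) (fun j _ => by positivity)
        (Finset.mem_univ i)
    have h4 : ‖X i i‖ ^ 2 ≤ ∑ j, ‖X i j‖ ^ 2 :=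
      Finset.single_le_sum (f := fun j => ‖X i j‖ ^ 2) (fun j _ => by positivity)
        (Finset.mem_univ i)
    have h5 := mul_le_mul h3 h4 (by positivity) hA0
    linarith
  have hsum : (ΓA + ΓL + 1 + β) * ∑ i, ∑ j, ‖X i j‖ ^ 2 +
      (ΓA + ΓL + 1) * ∑ i, z i ⬝ᵥ z i + (ΓA + ΓL + 1) * ∑ i, l i ⬝ᵥ l i
      - ∑ i, l i ⬝ᵥ 𝒢.mulA i (X i i) + ∑ i, l i ⬝ᵥ lap W z i ≤ precond 𝒢 W α ν δ X z l := by
    rw [precond]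
    simp only [Finset.sum_add_distrib, Finset.sum_sub_distrib]
    have hnn : ∀ w : Fin m → ℝ, 0 ≤ w ⬝ᵥ w := fun w => by
      simpa using dotProduct_self_star_nonneg w
    have e1 : (ΓA + ΓL + 1 + β) * ∑ i, ∑ j, ‖X i j‖ ^ 2 ≤
        ∑ i, (2 * α i)⁻¹ * ∑ j, ‖X i j‖ ^ 2 := by
      rw [Finset.mul_sum]
      exact Finset.sum_le_sum fun i _ => mul_le_mul_of_nonneg_right (hα i) (by positivity)
    have e2 : (ΓA + ΓL + 1) * ∑ i, z i ⬝ᵥ z i ≤ ∑ i, (2 * ν i)⁻¹ * (z i ⬝ᵥ z i) := by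
      rw [Finset.mul_sum]
      exact Finset.sum_le_sum fun i _ => mul_le_mul_of_nonneg_right (hν i) (hnn _)
    have e3 : (ΓA + ΓL + 1) * ∑ i, l i ⬝ᵥ l i ≤ ∑ i, (2 * δ i)⁻¹ * (l i ⬝ᵥ l i) := by
      rw [Finset.mul_sum]
      exact Finset.sum_le_sum fun i _ => mul_le_mul_of_nonneg_right (hδ i) (hnn _)
    linarith
  have hz : 0 ≤ ∑ i, z i ⬝ᵥ z i := Finset.sum_nonneg fun i _ => by
    simpa using dotProduct_self_star_nonneg (z i)
  have hl : 0 ≤ ∑ i, l i ⬝ᵥ l i := Finset.sum_nonneg fun i _ => by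
    simpa using dotProduct_self_star_nonneg (l i)
  have hX : 0 ≤ ∑ i, ∑ j, ‖X i j‖ ^ 2 := by positivity
  nlinarith [mul_nonneg hA0 hz, mul_nonneg hL0 hz, mul_nonneg hA0 hl, mul_nonneg hL0 hl,
    mul_nonneg hA0 hX, mul_nonneg hL0 hX]

/-- This is polarization of a quadratic form. The off-diagonal terms produce exactly the
extrapolations `2a' - a` and `2ζ' - ζ` of the dual update. -/
theorem precond_three_point (α ν δ : Fin N → ℝ) (a a' : Fin N → Dec n)
    (ζ ζ' l l' : Fin N → Fin m → ℝ) :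
    precond 𝒢 W α ν δ a ζ l - precond 𝒢 W α ν δ a' ζ' l' -
      precond 𝒢 W α ν δ (a' - a) (ζ' - ζ) (l' - l) =
    ∑ i, ∑ j, (α i)⁻¹ * ⟪a i j - a' i j, a' i j⟫ + ∑ i, (ν i)⁻¹ * ((ζ i - ζ' i) ⬝ᵥ ζ' i) +
      ∑ i, (δ i)⁻¹ * ((l i - l' i) ⬝ᵥ l' i) +
      ∑ i, (l' i ⬝ᵥ 𝒢.mulA i ((2 : ℝ) • a' i i - a i i) - l i ⬝ᵥ 𝒢.mulA i (a' i i)) +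
      ∑ i, (l i ⬝ᵥ lap W ζ' i - l' i ⬝ᵥ lap W ((2 : ℝ) • ζ' - ζ) i) := by
  simp only [precond, ← Finset.sum_add_distrib, ← Finset.sum_sub_distrib]
  refine Finset.sum_congr rfl fun i _ => ?_
  have h1 : ∑ j, (α i)⁻¹ * ⟪a i j - a' i j, a' i j⟫ =
      (2 * α i)⁻¹ * ∑ j, ‖a i j‖ ^ 2 - (2 * α i)⁻¹ * ∑ j, ‖a' i j‖ ^ 2 -
        (2 * α i)⁻¹ * ∑ j, ‖(a' - a) i j‖ ^ 2 := by
    simp only [Finset.mul_sum, ← Finset.sum_sub_distrib]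
    refine Finset.sum_congr rfl fun j _ => ?_
    simp only [Pi.sub_apply]
    rw [norm_sub_sq_real, inner_sub_left, real_inner_self_eq_norm_sq, real_inner_comm, mul_inv]
    ring
  have h2 : ∀ (t : ℝ) (x y : Fin m → ℝ), t⁻¹ * ((x - y) ⬝ᵥ y) = (2 * t)⁻¹ * (x ⬝ᵥ x) -
      (2 * t)⁻¹ * (y ⬝ᵥ y) - (2 * t)⁻¹ * ((y - x) ⬝ᵥ (y - x)) := by
    intro t x y
    simp only [sub_dotProduct, dotProduct_sub, mul_inv]
    rw [dotProduct_comm y x]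
    ring
  have h3 : lap W ((2 : ℝ) • ζ' - ζ) i = (2 : ℝ) • lap W ζ' i - lap W ζ i := by
    rw [lap_sub]
    simp only [lap, Finset.smul_sum]
    congr 1
    exact Finset.sum_congr rfl fun j _ => by simp only [Pi.smul_apply]; module
  rw [h1, h2, h2, h3, lap_sub]
  simp only [Pi.sub_apply, sub_dotProduct, dotProduct_sub, dotProduct_smul, smul_eq_mul,
    Game.mulA_sub, Game.mulA_smul]
  ring

end Lyapunov

/-! ### One-step descent towards a KKT point. -/

section Descent

variable {N m : ℕ} {n : Fin N → ℕ} {Ξ : Fin N → Type*} [∀ i, MeasurableSpace (Ξ i)]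
  {𝒢 : Game m n Ξ} {D : ∀ i, Set (EuclideanSpace ℝ (Fin (n i)))}
  {G : SimpleGraph (Fin N)} {W : Matrix (Fin N) (Fin N) ℝ}

/-- Local residuals minus an equal share of the total residual sum to zero, hence lie in the range
of the Laplacian. The remaining share is nonpositive and orthogonal to the multiplier. -/
theorem Game.IsKKT.exists_auxiliary {xs : Dec n} {ls : Fin m → ℝ} (hkkt : 𝒢.IsKKT xs ls)
    (hG : G.Connected) (hW : IsWeightMatrix G W) :
    ∃ zs : Fin N → Fin m → ℝ, ∀ (i : Fin N) (μ : Fin m → ℝ), 0 ≤ μ →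
      (𝒢.mulA i (xs i) - 𝒢.b i - lap W zs i) ⬝ᵥ (μ - ls) ≤ 0 := by
  have hN0 : N ≠ 0 := fun h => by subst h; exact hG.nonempty.elim fun i => i.elim0
  have hN : (N : ℝ) ≠ 0 := Nat.cast_ne_zero.2 hN0
  set r := ∑ i, 𝒢.mulA i (xs i) - ∑ i, 𝒢.b i with hr
  obtain ⟨zs, hzs⟩ := hW.exists_lap_eq hG
    (y := fun i => 𝒢.mulA i (xs i) - 𝒢.b i - (N : ℝ)⁻¹ • r) (by
      simp only [Finset.sum_sub_distrib, ← hr, Finset.sum_const, Finset.card_univ,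
        Fintype.card_fin, ← Nat.cast_smul_eq_nsmul ℝ, smul_smul, mul_inv_cancel₀ hN, one_smul,
        sub_self])
  refine ⟨zs, fun i μ hμ => ?_⟩
  rw [hzs, sub_sub_cancel, smul_dotProduct, dotProduct_sub, dotProduct_comm r ls, hkkt.2.2.1,
    sub_zero, smul_eq_mul]
  refine mul_nonpos_of_nonneg_of_nonpos (by positivity) ?_
  have h1 := dotProduct_nonneg_of_nonneg (v := -r) (w := μ)
    (neg_nonneg.2 (sub_nonpos.2 hkkt.1.2)) hμ
  rw [neg_dotProduct] at h1
  linarith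

theorem dotProduct_sub_sup_zero_nonneg (w : Fin m → ℝ) {μ : Fin m → ℝ} (hμ : 0 ≤ μ) :
    0 ≤ (w - w ⊔ 0) ⬝ᵥ (w ⊔ 0 - μ) := by
  refine Finset.sum_nonneg fun r _ => ?_
  simp only [Pi.sub_apply, Pi.sup_apply, Pi.zero_apply]
  rcases le_total 0 (w r) with h | h
  · rw [sup_of_le_left h, sub_self, zero_mul]
  · rw [sup_of_le_right h]
    have := hμ r
    simp only [Pi.zero_apply] at this
    nlinarith

theorem Game.IsProx.isProxOn {i : Fin N} {a : ℝ} {v p : EuclideanSpace ℝ (Fin (n i))}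
    (h : 𝒢.IsProx i a v p) : IsProxOn (𝒢.Ω i) (𝒢.g i) a v p := h

/-- Add the prox inequality tested at `xs` and the KKT subgradient inequality tested at the new
decision; the values of `g` cancel. -/
theorem IsTrajectory.decision_step (h𝒢 : 𝒢.Regular D) {c : ℝ} {α ν δ : Fin N → ℝ} {M : ℕ → ℕ}
    {s : ℕ → ℕ → ∀ i, Ξ i} {X : ℕ → Fin N → Dec n} {z l : ℕ → Fin N → Fin m → ℝ}
    (htr : IsTrajectory 𝒢 W c α ν δ M s X z l) (hα : ∀ i, 0 < α i) {xs : Dec n} {ls : Fin m → ℝ}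
    (hkkt : 𝒢.IsKKT xs ls) (k : ℕ) (i : Fin N) :
    ⟪𝒢.sampledF i (M k) (X k i) (fun t => s k t i) - 𝒢.F i xs, X (k + 1) i i - xs i⟫ +
      (l k i - ls) ⬝ᵥ 𝒢.mulA i (X (k + 1) i i - xs i) +
      c * ⟪lap W (fun h => X k h i) i, X (k + 1) i i - xs i⟫ ≤
    (α i)⁻¹ * ⟪X k i i - X (k + 1) i i, X (k + 1) i i - xs i⟫ := by
  have hprox := (htr.decision k i).isProxOn
  have h1 := hprox.variational (h𝒢.g_convex i) (hα i).le (hkkt.1.1 i)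
  have h2 := (hkkt.2.2.2 i).2 _ hprox.1
  set p := X (k + 1) i i with hp
  set q := 𝒢.sampledF i (M k) (X k i) (fun t => s k t i)
  have h3 : p - (X k i i - α i • (q + 𝒢.mulAT i (l k i) + c • ∑ j, W i j • (X k i i - X k j i))) =
      α i • (q + 𝒢.mulAT i (l k i) + c • lap W (fun h => X k h i) i) - (X k i i - p) := by
    simp only [lap]
    abel
  rw [h3, ← neg_sub p (xs i), inner_neg_right, inner_sub_left (α i • _), inner_smul_left] at h1
  simp only [conj_trivial] at h1
  have h4 : ⟪q + 𝒢.mulAT i (l k i) + c • lap W (fun h => X k h i) i, p - xs i⟫ +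
      ⟪- 𝒢.F i xs - 𝒢.mulAT i ls, p - xs i⟫ =
      ⟪q - 𝒢.F i xs, p - xs i⟫ + (l k i - ls) ⬝ᵥ 𝒢.mulA i (p - xs i) +
        c * ⟪lap W (fun h => X k h i) i, p - xs i⟫ := by
    rw [← Game.inner_mulAT, Game.mulAT_sub]
    simp only [inner_add_left, inner_sub_left, inner_neg_left, inner_smul_left, conj_trivial]
    ring
  rw [← h4, ← mul_le_mul_iff_right₀ (hα i), mul_inv_cancel_left₀ (hα i).ne']
  have h5 := mul_le_mul_of_nonneg_left h2 (hα i).le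
  linarith

/-- The projection inequality is tested at `ls` and recentred at the KKT point; the leftover
constant residual has the right sign by `hzs`. -/
theorem IsTrajectory.dual_step {c : ℝ} {α ν δ : Fin N → ℝ} {M : ℕ → ℕ}
    {s : ℕ → ℕ → ∀ i, Ξ i} {X : ℕ → Fin N → Dec n} {z l : ℕ → Fin N → Fin m → ℝ}
    (htr : IsTrajectory 𝒢 W c α ν δ M s X z l) (hδ : ∀ i, 0 < δ i) {xs : Dec n} {ls : Fin m → ℝ}
    (hls : 0 ≤ ls) {zs : Fin N → Fin m → ℝ} (hzs : ∀ (i : Fin N) (μ : Fin m → ℝ), 0 ≤ μ →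
      (𝒢.mulA i (xs i) - 𝒢.b i - lap W zs i) ⬝ᵥ (μ - ls) ≤ 0) (k : ℕ) (i : Fin N) :
    (l (k + 1) i - ls) ⬝ᵥ lap W ((2 : ℝ) • (z (k + 1) - zs) - (z k - zs)) i -
      (l (k + 1) i - ls) ⬝ᵥ
        𝒢.mulA i ((2 : ℝ) • (X (k + 1) i i - xs i) - (X k i i - xs i)) ≤
    (δ i)⁻¹ * ((l k i - l (k + 1) i) ⬝ᵥ (l (k + 1) i - ls)) := by
  set e := 𝒢.mulA i ((2 : ℝ) • X (k + 1) i i - X k i i) - 𝒢.b i -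
    ∑ j, W i j • ((2 : ℝ) • (z (k + 1) i - z (k + 1) j) - (z k i - z k j)) with he
  have hl : l (k + 1) i = (l k i + δ i • e) ⊔ 0 := htr.dual k i
  have h1 := dotProduct_sub_sup_zero_nonneg (l k i + δ i • e) hls
  have h2 := hzs i (l (k + 1) i) (hl ▸ le_sup_right)
  rw [← hl] at h1
  have h3 : e = 𝒢.mulA i ((2 : ℝ) • (X (k + 1) i i - xs i) - (X k i i - xs i)) -
      lap W ((2 : ℝ) • (z (k + 1) - zs) - (z k - zs)) i +
      (𝒢.mulA i (xs i) - 𝒢.b i - lap W zs i) := by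
    have h4 : ∑ j, W i j • ((2 : ℝ) • (z (k + 1) i - z (k + 1) j) - (z k i - z k j)) =
        lap W ((2 : ℝ) • (z (k + 1) - zs) - (z k - zs)) i + lap W zs i := by
      simp only [lap, ← Finset.sum_add_distrib]
      exact Finset.sum_congr rfl fun j _ => by
        simp only [Pi.sub_apply, Pi.smul_apply]; module
    rw [he, h4]
    simp only [Game.mulA_sub, Game.mulA_smul]
    module
  set p := 𝒢.mulA i ((2 : ℝ) • (X (k + 1) i i - xs i) - (X k i i - xs i))
  set q := lap W ((2 : ℝ) • (z (k + 1) - zs) - (z k - zs)) i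
  set w := 𝒢.mulA i (xs i) - 𝒢.b i - lap W zs i
  have h5 : (l k i + δ i • e - l (k + 1) i) ⬝ᵥ (l (k + 1) i - ls) =
      (l k i - l (k + 1) i) ⬝ᵥ (l (k + 1) i - ls) + δ i * (p ⬝ᵥ (l (k + 1) i - ls) -
        q ⬝ᵥ (l (k + 1) i - ls) + w ⬝ᵥ (l (k + 1) i - ls)) := by
    rw [← sub_dotProduct, ← add_dotProduct, ← h3, ← smul_eq_mul, ← smul_dotProduct,
      ← add_dotProduct]
    congr 1
    abel
  rw [h5] at h1
  rw [dotProduct_comm _ q, dotProduct_comm _ p, ← mul_le_mul_iff_right₀ (hδ i),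
    mul_inv_cancel_left₀ (hδ i).ne']
  have h6 := mul_nonpos_of_nonneg_of_nonpos (hδ i).le h2
  linarith

/-- Summed over the agents, the primal, auxiliary and dual relations match the three-point identity:
the couplings through `A` and through the auxiliary variables cancel, leaving the pseudogradient and
consensus terms. -/
theorem IsTrajectory.precond_step (h𝒢 : 𝒢.Regular D) (hW : IsWeightMatrix G W) {c : ℝ}
    {α ν δ : Fin N → ℝ} {M : ℕ → ℕ}
    {s : ℕ → ℕ → ∀ i, Ξ i} {X : ℕ → Fin N → Dec n} {z l : ℕ → Fin N → Fin m → ℝ}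
    (htr : IsTrajectory 𝒢 W c α ν δ M s X z l) (hα : ∀ i, 0 < α i) (hν : ∀ i, 0 < ν i)
    (hδ : ∀ i, 0 < δ i) {xs : Dec n} {ls : Fin m → ℝ} (hkkt : 𝒢.IsKKT xs ls)
    {zs : Fin N → Fin m → ℝ} (hzs : ∀ (i : Fin N) (μ : Fin m → ℝ), 0 ≤ μ →
      (𝒢.mulA i (xs i) - 𝒢.b i - lap W zs i) ⬝ᵥ (μ - ls) ≤ 0) (k : ℕ) :
    ∑ i, ⟪𝒢.sampledF i (M k) (X k i) (fun t => s k t i) - 𝒢.F i xs, X (k + 1) i i - xs i⟫ +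
      c * ∑ i, ∑ j, ⟪lap W (fun h => X k h j) i, X (k + 1) i j - xs j⟫ +
      precond 𝒢 W α ν δ (X (k + 1) - X k) (z (k + 1) - z k) (l (k + 1) - l k) +
      precond 𝒢 W α ν δ (fun i => X (k + 1) i - xs) (z (k + 1) - zs) (fun i => l (k + 1) i - ls) ≤
    precond 𝒢 W α ν δ (fun i => X k i - xs) (z k - zs) (fun i => l k i - ls) := by
  have h3pt := precond_three_point (𝒢 := 𝒢) (W := W) α ν δ (fun i => X k i - xs)
    (fun i => X (k + 1) i - xs) (z k - zs) (z (k + 1) - zs) (fun i => l k i - ls)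
    (fun i => l (k + 1) i - ls)
  have e1 : (fun i => X (k + 1) i - xs) - (fun i => X k i - xs) = X (k + 1) - X k := by
    funext i; simp
  have e2 : (fun i => l (k + 1) i - ls) - (fun i => l k i - ls) = l (k + 1) - l k := by
    funext i; simp
  rw [e1, e2, sub_sub_sub_cancel_right] at h3pt
  simp only [Pi.sub_apply, sub_sub_sub_cancel_right, Finset.sum_sub_distrib] at h3pt
  have hH1 : ∑ i, ⟪𝒢.sampledF i (M k) (X k i) (fun t => s k t i) - 𝒢.F i xs,
      X (k + 1) i i - xs i⟫ + ∑ i, (l k i - ls) ⬝ᵥ 𝒢.mulA i (X (k + 1) i i - xs i) +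
      c * ∑ i, ∑ j, ⟪lap W (fun h => X k h j) i, X (k + 1) i j - xs j⟫ ≤
      ∑ i, ∑ j, (α i)⁻¹ * ⟪X k i j - X (k + 1) i j, X (k + 1) i j - xs j⟫ := by
    rw [Finset.mul_sum, ← Finset.sum_add_distrib, ← Finset.sum_add_distrib]
    refine Finset.sum_le_sum fun i _ => ?_
    rw [← Finset.add_sum_erase _ _ (Finset.mem_univ i),
      ← Finset.add_sum_erase _ (fun j => (α i)⁻¹ * _) (Finset.mem_univ i)]
    have h1 := htr.decision_step h𝒢 hα hkkt k i
    -- Estimates of other agents' decisions follow an explicit step, so these blocks give equality.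
    have h2 : c * ∑ j ∈ Finset.univ.erase i,
        ⟪lap W (fun h => X k h j) i, X (k + 1) i j - xs j⟫ =
        ∑ j ∈ Finset.univ.erase i, (α i)⁻¹ * ⟪X k i j - X (k + 1) i j, X (k + 1) i j - xs j⟫ := by
      rw [Finset.mul_sum]
      refine Finset.sum_congr rfl fun j hj => ?_
      have h3 : X k i j - X (k + 1) i j = (α i * c) • lap W (fun h => X k h j) i := by
        rw [htr.estimate k i j (Finset.ne_of_mem_erase hj)]
        exact sub_sub_cancel _ _
      rw [h3, inner_smul_left]
      simp only [conj_trivial]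
      rw [← mul_assoc, ← mul_assoc, inv_mul_cancel₀ (hα i).ne', one_mul]
    rw [mul_add]
    linarith
  have hH2 : ∑ i, (ν i)⁻¹ * ((z k i - z (k + 1) i) ⬝ᵥ (z (k + 1) i - zs i)) =
      - ∑ i, (l k i - ls) ⬝ᵥ lap W (z (k + 1) - zs) i := by
    have h1 := hW.sum_lap_dotProduct (fun i => l k i - ls) (z (k + 1) - zs)
    rw [← h1, ← Finset.sum_neg_distrib]
    refine Finset.sum_congr rfl fun i _ => ?_
    have h2 : z k i - z (k + 1) i = - (ν i • lap W (fun i => l k i - ls) i) := by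
      rw [htr.auxiliary k i]
      simp [lap]
    rw [h2, neg_dotProduct, smul_dotProduct, smul_eq_mul, mul_neg,
      inv_mul_cancel_left₀ (hν i).ne']
    rfl
  have hH3 := Finset.sum_le_sum fun i (_ : i ∈ Finset.univ) =>
    htr.dual_step hδ hkkt.2.1 hzs k i
  simp only [Finset.sum_sub_distrib] at hH3
  linarith

/-- The estimates stay in the domain of the pseudogradient. -/
theorem IsTrajectory.mem_dom (h𝒢 : 𝒢.Regular D) {c : ℝ} {α ν δ : Fin N → ℝ} {M : ℕ → ℕ}
    {s : ℕ → ℕ → ∀ i, Ξ i} {X : ℕ → Fin N → Dec n} {z l : ℕ → Fin N → Fin m → ℝ}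
    (htr : IsTrajectory 𝒢 W c α ν δ M s X z l) (hα : ∀ i, 0 < α i)
    (hcW : ∀ i j, 0 ≤ c * W i j) (hαc : ∀ i, α i * ∑ j, c * W i j ≤ 1)
    (h0 : ∀ i j, X 0 i j ∈ D j) (k : ℕ) (i j : Fin N) : X k i j ∈ D j := by
  induction k generalizing i j with
  | zero => exact h0 i j
  | succ k ih =>
    rcases eq_or_ne j i with rfl | hj
    · exact h𝒢.subset_dom j (htr.decision k j).1
    · rw [htr.estimate k i j hj]
      -- The new estimate is a convex combination of current ones; `none` carries the weight left to
      -- the agent's own estimate.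
      have e : X k i j - (α i * c) • ∑ h, W i h • (X k i j - X k h j) =
          ∑ o : Option (Fin N), (o.elim (1 - α i * ∑ h, c * W i h) fun h => α i * (c * W i h)) •
            (o.elim (X k i j) fun h => X k h j) := by
        simp only [Fintype.sum_option, Option.elim, sub_smul, one_smul, Finset.smul_sum, smul_sub,
          Finset.sum_sub_distrib, Finset.mul_sum, Finset.sum_smul, smul_smul, mul_assoc]
        abel
      rw [e]
      refine (h𝒢.convex_dom j).sum_mem (fun o _ => ?_) ?_ fun o _ => ?_
      · cases o with
        | none => exact sub_nonneg.2 (hαc i)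
        | some h => exact mul_nonneg (hα i).le (hcW i h)
      · simp [Fintype.sum_option, Finset.mul_sum]
      · cases o with
        | none => exact ih i j
        | some h => exact ih h j

end Descent

/-! ### Convergence along a fixed sample path. -/

section PathwiseConvergence

variable {N m : ℕ} {n : Fin N → ℕ} {Ξ : Fin N → Type*} [∀ i, MeasurableSpace (Ξ i)]
  {𝒢 : Game m n Ξ} {D : ∀ i, Set (EuclideanSpace ℝ (Fin (n i)))}
  {G : SimpleGraph (Fin N)} {W : Matrix (Fin N) (Fin N) ℝ}

theorem neg_weighted_le_inner {V : Type*} [NormedAddCommGroup V] [InnerProductSpace ℝ V]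
    {t : ℝ} (ht : 0 < t) (p q : V) :
    - (t / 2 * ‖p‖ ^ 2 + (2 * t)⁻¹ * ‖q‖ ^ 2) ≤ ⟪p, q⟫ := by
  have h1 : 0 ≤ (2 * t)⁻¹ * ‖t • p + q‖ ^ 2 := by positivity
  rw [norm_add_sq_real, inner_smul_left, norm_smul, Real.norm_of_nonneg ht.le] at h1
  simp only [conj_trivial] at h1
  have h2 : (2 * t)⁻¹ * ((t * ‖p‖) ^ 2 + 2 * (t * ⟪p, q⟫) + ‖q‖ ^ 2) =
      t / 2 * ‖p‖ ^ 2 + ⟪p, q⟫ + (2 * t)⁻¹ * ‖q‖ ^ 2 := by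
    field_simp
  linarith

/-- Telescoping bounds the partial sums of `S`, so `S` is even summable. -/
theorem tendsto_zero_of_descent {V S E : ℕ → ℝ} {κ C : ℝ} (hκ : 0 < κ) (hC : 0 ≤ C)
    (hV : ∀ k, 0 ≤ V k) (hS : ∀ k, 0 ≤ S k) (hE : Summable E) (hE0 : ∀ k, 0 ≤ E k)
    (h : ∀ k, V (k + 1) + κ * S k ≤ V k + C * E k) : Tendsto S atTop (𝓝 0) := by
  refine Summable.tendsto_atTop_zero ?_
  have h1 : ∀ K, V K + κ * ∑ k ∈ Finset.range K, S k ≤ V 0 + C * ∑ k ∈ Finset.range K, E k := by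
    intro K
    induction K with
    | zero => simp
    | succ K ih =>
      rw [Finset.sum_range_succ, Finset.sum_range_succ]
      have := h K
      linarith
  refine summable_of_sum_range_le (c := (V 0 + C * ∑' k, E k) / κ) hS fun K => ?_
  rw [le_div_iff₀' hκ]
  have h2 := mul_le_mul_of_nonneg_left (hE.sum_le_tsum (Finset.range K) fun k _ => hE0 k) hC
  linarith [h1 K, hV K]

/-- Absorbing the noise and the forward step into the strong monotonicity of the extended
operator. -/
theorem exists_forward_lower_bound {ℓp c κ : ℝ} (hℓp : 0 < ℓp) (hκ : 0 < κ)
    (hext : 𝒢.ExtLipschitz D ℓp) :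
    ∃ β C : ℝ, 0 ≤ β ∧ 0 ≤ C ∧ ∀ (X X' : Fin N → Dec n) (xs e : Dec n), (∀ i j, X i j ∈ D j) →
      (∀ j, xs j ∈ D j) →
      κ * ∑ i, ∑ j, ‖X i j - xs j‖ ^ 2 ≤ ∑ i, ⟪𝒢.F i (X i) - 𝒢.F i xs, X i i - xs i⟫ +
        c * ∑ i, ∑ j, ⟪lap W (fun h => X h j) i, X i j - xs j⟫ →
      κ / 4 * ∑ i, ∑ j, ‖X i j - xs j‖ ^ 2 ≤
        ∑ i, ⟪e i - 𝒢.F i xs, X' i i - xs i⟫ +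
        c * ∑ i, ∑ j, ⟪lap W (fun h => X h j) i, X' i j - xs j⟫ +
        β * ∑ i, ∑ j, ‖X' i j - X i j‖ ^ 2 + C * ∑ i, ‖e i - 𝒢.F i (X i)‖ ^ 2 := by
  set ΓL := ∑ i, ∑ j, laplacian W i j ^ 2 with hΓL
  have hL0 : 0 ≤ ΓL := by positivity
  set B := ℓp ^ 2 + c ^ 2 * ΓL with hB
  have hB0 : 0 < B := by positivity
  -- With this weight, the Lipschitz and Laplacian displacement terms together cost κ/4 of `S`; the
  -- noise costs another κ/4.
  set t := κ / (2 * B) with ht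
  have ht0 : 0 < t := by positivity
  refine ⟨(2 * t)⁻¹ + (2 * t)⁻¹ + 1 / 2, κ⁻¹ + 1 / 2, by positivity, by positivity,
    fun X X' xs e hX hxs hmono => ?_⟩
  set S := ∑ i, ∑ j, ‖X i j - xs j‖ ^ 2 with hS
  set T := ∑ i, ∑ j, ‖X' i j - X i j‖ ^ 2 with hT
  set Q := ∑ i, ‖e i - 𝒢.F i (X i)‖ ^ 2 with hQ
  have hS0 : 0 ≤ S := Finset.sum_nonneg fun i _ => Finset.sum_nonneg fun j _ => sq_nonneg _
  have hSd : ∑ i, ‖X i i - xs i‖ ^ 2 ≤ S := Finset.sum_le_sum fun i _ =>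
    Finset.single_le_sum (f := fun j => ‖X i j - xs j‖ ^ 2) (fun j _ => sq_nonneg _)
      (Finset.mem_univ i)
  have hTd : ∑ i, ‖X' i i - X i i‖ ^ 2 ≤ T := Finset.sum_le_sum fun i _ =>
    Finset.single_le_sum (f := fun j => ‖X' i j - X i j‖ ^ 2) (fun j _ => sq_nonneg _)
      (Finset.mem_univ i)
  -- The operator is evaluated at the old state but tested at the new one; both the displacement and
  -- the noise are split off.
  have hsplit : ∀ i, ⟪e i - 𝒢.F i xs, X' i i - xs i⟫ =
      ⟪𝒢.F i (X i) - 𝒢.F i xs, X i i - xs i⟫ + ⟪𝒢.F i (X i) - 𝒢.F i xs, X' i i - X i i⟫ +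
      ⟪e i - 𝒢.F i (X i), X i i - xs i⟫ + ⟪e i - 𝒢.F i (X i), X' i i - X i i⟫ := by
    intro i
    simp only [inner_sub_left, inner_sub_right]
    ring
  have hsplit' : ∑ i, ∑ j, ⟪lap W (fun h => X h j) i, X' i j - xs j⟫ =
      ∑ i, ∑ j, ⟪lap W (fun h => X h j) i, X i j - xs j⟫ +
      ∑ i, ∑ j, ⟪lap W (fun h => X h j) i, X' i j - X i j⟫ := by
    simp only [← Finset.sum_add_distrib]
    refine Finset.sum_congr rfl fun i _ => Finset.sum_congr rfl fun j _ => ?_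
    rw [← inner_add_right, add_comm (X i j - xs j), sub_add_sub_cancel]
  have h1 : - (t / 2 * (ℓp ^ 2 * S) + (2 * t)⁻¹ * T) ≤
      ∑ i, ⟪𝒢.F i (X i) - 𝒢.F i xs, X' i i - X i i⟫ := by
    have h2 := hext.sum_sq_le hX (Y := fun _ => xs) fun _ => hxs
    have h3 : - (t / 2 * ∑ i, ‖𝒢.F i (X i) - 𝒢.F i xs‖ ^ 2 +
        (2 * t)⁻¹ * ∑ i, ‖X' i i - X i i‖ ^ 2) ≤
        ∑ i, ⟪𝒢.F i (X i) - 𝒢.F i xs, X' i i - X i i⟫ := by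
      rw [Finset.mul_sum, Finset.mul_sum, ← Finset.sum_add_distrib, ← Finset.sum_neg_distrib]
      exact Finset.sum_le_sum fun i _ => neg_weighted_le_inner ht0 _ _
    have h4 := mul_le_mul_of_nonneg_left h2 (by positivity : 0 ≤ t / 2)
    have h5 := mul_le_mul_of_nonneg_left hTd (by positivity : 0 ≤ (2 * t)⁻¹)
    linarith
  have h2 : - (κ / 4 * S + κ⁻¹ * Q) ≤ ∑ i, ⟪e i - 𝒢.F i (X i), X i i - xs i⟫ := by
    have h3 : - (κ⁻¹ * Q + κ / 4 * ∑ i, ‖X i i - xs i‖ ^ 2) ≤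
        ∑ i, ⟪e i - 𝒢.F i (X i), X i i - xs i⟫ := by
      rw [hQ, Finset.mul_sum, Finset.mul_sum, ← Finset.sum_add_distrib, ← Finset.sum_neg_distrib]
      refine Finset.sum_le_sum fun i _ => ?_
      have h4 := neg_weighted_le_inner (by positivity : 0 < 2 * κ⁻¹) (e i - 𝒢.F i (X i))
        (X i i - xs i)
      have h5 : (2 * (2 * κ⁻¹))⁻¹ = κ / 4 := by field_simp; norm_num
      rw [h5] at h4
      linarith
    have h4 := mul_le_mul_of_nonneg_left hSd (by positivity : 0 ≤ κ / 4)
    linarith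
  have h3 : - (1 / 2 * Q + 1 / 2 * T) ≤ ∑ i, ⟪e i - 𝒢.F i (X i), X' i i - X i i⟫ := by
    have h4 : - (1 / 2 * Q + 1 / 2 * ∑ i, ‖X' i i - X i i‖ ^ 2) ≤
        ∑ i, ⟪e i - 𝒢.F i (X i), X' i i - X i i⟫ := by
      rw [hQ, Finset.mul_sum, Finset.mul_sum, ← Finset.sum_add_distrib, ← Finset.sum_neg_distrib]
      refine Finset.sum_le_sum fun i _ => ?_
      have h4 := neg_weighted_le_inner one_pos (e i - 𝒢.F i (X i)) (X' i i - X i i)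
      norm_num at h4 ⊢
      linarith
    linarith
  have h4 : - (t / 2 * (c ^ 2 * ΓL * S) + (2 * t)⁻¹ * T) ≤
      c * ∑ i, ∑ j, ⟪lap W (fun h => X h j) i, X' i j - X i j⟫ := by
    have h5 : ∑ i, ∑ j, ‖lap W (fun h => X h j) i‖ ^ 2 ≤ ΓL * S := by
      have e1 : ∑ i, ∑ j, ‖lap W (fun h => X h j) i‖ ^ 2 =
        ∑ j, ∑ i, ‖lap W (fun h => X h j) i‖ ^ 2 := Finset.sum_comm
      have e2 : S = ∑ j, ∑ i, ‖X i j - xs j‖ ^ 2 := Finset.sum_comm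
      rw [e1, e2, Finset.mul_sum]
      refine Finset.sum_le_sum fun j _ => ?_
      have h6 := sum_norm_lap_sq_le (W := W) ((fun h => X h j) - fun _ => xs j)
      simpa only [lap_sub, lap_const, sub_zero, Pi.sub_apply] using h6
    have h6 : - (t / 2 * (c ^ 2 * ∑ i, ∑ j, ‖lap W (fun h => X h j) i‖ ^ 2) + (2 * t)⁻¹ * T) ≤
        c * ∑ i, ∑ j, ⟪lap W (fun h => X h j) i, X' i j - X i j⟫ := by
      simp only [hT, Finset.mul_sum, ← Finset.sum_add_distrib, ← Finset.sum_neg_distrib]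
      refine Finset.sum_le_sum fun i _ => Finset.sum_le_sum fun j _ => ?_
      have h7 := neg_weighted_le_inner ht0 (c • lap W (fun h => X h j) i) (X' i j - X i j)
      rw [norm_smul, mul_pow, inner_smul_left] at h7
      simpa using h7
    have h7 := mul_le_mul_of_nonneg_left h5 (by positivity : 0 ≤ t / 2 * c ^ 2)
    linarith
  have h5 : t / 2 * (ℓp ^ 2 * S) + t / 2 * (c ^ 2 * ΓL * S) = κ / 4 * S := by
    have : t * B = κ / 2 := by rw [ht]; field_simp
    rw [hB] at this
    linear_combination (S / 2) * this
  rw [hsplit', mul_add]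
  simp only [hsplit, Finset.sum_add_distrib]
  linarith [mul_nonneg hκ.le hS0]

/-- Convergence of every trajectory along which the sampling errors are square summable. -/
theorem exists_stepsizes (h𝒢 : 𝒢.Regular D) {η ℓF ℓp : ℝ} (hη : 0 < η) (hℓF : 0 < ℓF)
    (hℓp : 0 < ℓp) (hmono : 𝒢.StronglyMonotone D η) (hlip : 𝒢.Lipschitz D ℓF)
    (hext : 𝒢.ExtLipschitz D ℓp) (hG : G.Connected) (hW : IsWeightMatrix G W) {c : ℝ}
    (hc : ∀ r : ℝ, Module.End.HasEigenvalue (Matrix.toLin' (laplacian W)) r → r ≠ 0 →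
      (ℓp + ℓF) ^ 2 / (4 * η) + ℓp < c * r) {xs : Dec n} {ls : Fin m → ℝ}
    (hkkt : 𝒢.IsKKT xs ls) :
    ∃ αbar νbar δbar : ℝ, 0 < αbar ∧ 0 < νbar ∧ 0 < δbar ∧
      ∀ α ν δ : Fin N → ℝ, (∀ i, α i ∈ Set.Ioo 0 αbar) → (∀ i, ν i ∈ Set.Ioo 0 νbar) →
        (∀ i, δ i ∈ Set.Ioo 0 δbar) →
      ∀ (M : ℕ → ℕ) (s : ℕ → ℕ → ∀ i, Ξ i) (X : ℕ → Fin N → Dec n)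
        (z l : ℕ → Fin N → Fin m → ℝ), IsTrajectory 𝒢 W c α ν δ M s X z l →
        (∀ i j, X 0 i j ∈ D j) →
        (∀ k i j, X k i j ∈ D j) ∧
        ((Summable fun k => ∑ i,
          ‖𝒢.sampledF i (M k) (X k i) (fun t => s k t i) - 𝒢.F i (X k i)‖ ^ 2) →
        Tendsto (fun k => (fun i => X k i i : Dec n)) atTop (𝓝 xs)) := by
  obtain ⟨τ, hτ, hcoer⟩ := hW.exists_coercive hG hc
  have hτ0 : 0 < τ := lt_trans (by positivity) hτ
  have hcW := hW.mul_weight_nonneg hτ0 hcoer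
  obtain ⟨κ, hκ, hrsm⟩ := exists_restricted_strong_monotonicity h𝒢.convex_dom hη hℓF hℓp hmono
    hlip hext hG hW hτ hcoer
  obtain ⟨β, C, hβ, hC, hfwd⟩ := exists_forward_lower_bound (W := W) (c := c) hℓp hκ hext
  obtain ⟨Γ, hΓ, hprec⟩ := exists_le_precond 𝒢 W
  obtain ⟨zs, hzs⟩ := hkkt.exists_auxiliary hG hW
  set w := ∑ i, ∑ j, c * W i j with hw
  have hw0 : 0 ≤ w := Finset.sum_nonneg fun i _ => Finset.sum_nonneg fun j _ => hcW i j
  have hbound : ∀ {Λ a : ℝ}, 0 ≤ Λ → a ∈ Set.Ioo 0 (2 * (Λ + 1))⁻¹ → Λ ≤ (2 * a)⁻¹ := by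
    intro Λ a hΛ ha
    have h1 : Λ * (2 * a) ≤ 1 := by
      have h2 := mul_lt_mul_of_pos_left ha.2 (by positivity : 0 < 2 * (Λ + 1))
      rw [mul_inv_cancel₀ (by positivity)] at h2
      nlinarith [ha.1]
    rw [← one_div, le_div_iff₀ (mul_pos two_pos ha.1)]
    exact h1
  -- By `hbound`, `Γ` makes the metric nonnegative, `β` pays for the displacement, and `w` keeps the
  -- consensus weights nonnegative.
  refine ⟨(2 * (Γ + β + w + 1))⁻¹, (2 * (Γ + 1))⁻¹, (2 * (Γ + 1))⁻¹, by positivity, by positivity,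
    by positivity, fun α ν δ hα hν hδ M s X z l htr hX0 => ?_⟩
  have hα1 : ∀ i, Γ + β + w ≤ (2 * α i)⁻¹ := fun i => hbound (by positivity) (hα i)
  have hα2 : ∀ i, Γ + β ≤ (2 * α i)⁻¹ := fun i => by linarith [hα1 i]
  have hν2 : ∀ i, Γ ≤ (2 * ν i)⁻¹ := fun i => hbound hΓ (hν i)
  have hδ2 : ∀ i, Γ ≤ (2 * δ i)⁻¹ := fun i => hbound hΓ (hδ i)
  have hαc : ∀ i, α i * ∑ j, c * W i j ≤ 1 := by
    intro i
    have h1 : ∑ j, c * W i j ≤ w := Finset.single_le_sum (f := fun i => ∑ j, c * W i j)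
      (fun i _ => Finset.sum_nonneg fun j _ => hcW i j) (Finset.mem_univ i)
    have h2 : w ≤ (2 * α i)⁻¹ := by linarith [hα1 i]
    have h3 := mul_le_mul_of_nonneg_left (h1.trans h2) (hα i).1.le
    have h4 : α i * (2 * α i)⁻¹ = 1 / 2 := by
      have := (hα i).1.ne'
      field_simp
    linarith
  have hXD := htr.mem_dom h𝒢 (fun i => (hα i).1) hcW hαc hX0
  refine ⟨hXD, fun hsum => ?_⟩
  have hxsD : ∀ j, xs j ∈ D j := fun j => h𝒢.subset_dom j (hkkt.1.1 j)
  have hlim : Tendsto (fun k => ∑ i, ∑ j, ‖X k i j - xs j‖ ^ 2) atTop (𝓝 0) := by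
    refine tendsto_zero_of_descent
      (V := fun k => precond 𝒢 W α ν δ (fun i => X k i - xs) (z k - zs) (fun i => l k i - ls))
      (by positivity : 0 < κ / 4) hC (fun k => ?_) (fun k => ?_) hsum (fun k => ?_) fun k => ?_
    · have h1 := hprec 0 α ν δ le_rfl (fun i => by linarith [hα2 i]) hν2 hδ2
        (fun i => X k i - xs) (z k - zs) (fun i => l k i - ls)
      rwa [zero_mul] at h1
    · exact Finset.sum_nonneg fun i _ => Finset.sum_nonneg fun j _ => sq_nonneg _
    · exact Finset.sum_nonneg fun i _ => sq_nonneg _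
    · have h1 := htr.precond_step h𝒢 hW (fun i => (hα i).1) (fun i => (hν i).1)
        (fun i => (hδ i).1) hkkt hzs k
      have h2 := hfwd (X k) (X (k + 1)) xs
        (fun i => 𝒢.sampledF i (M k) (X k i) (fun t => s k t i)) (hXD k) hxsD
        (hrsm (X k) xs (hXD k) hxsD)
      have h3 := hprec β α ν δ hβ hα2 hν2 hδ2 (X (k + 1) - X k) (z (k + 1) - z k)
        (l (k + 1) - l k)
      simp only [Pi.sub_apply] at h3
      linarith
  rw [tendsto_pi_nhds]
  intro i
  rw [tendsto_iff_norm_sub_tendsto_zero]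
  have h1 : Tendsto (fun k => ‖X k i i - xs i‖ ^ 2) atTop (𝓝 0) := by
    refine squeeze_zero (fun k => sq_nonneg _) (fun k => ?_) hlim
    exact (Finset.single_le_sum (f := fun j => ‖X k i j - xs j‖ ^ 2) (fun j _ => sq_nonneg _)
      (Finset.mem_univ i)).trans (Finset.single_le_sum
        (f := fun i => ∑ j, ‖X k i j - xs j‖ ^ 2)
        (fun i _ => Finset.sum_nonneg fun j _ => sq_nonneg _) (Finset.mem_univ i))
  have h2 := h1.sqrt
  simpa using h2

end PathwiseConvergence

/-! ### Independence and second moments of batch averages. -/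

section Independence

variable {S : Type*} [MeasurableSpace S] {μ : Measure S} [IsProbabilityMeasure μ]

/-- The joint law is a product measure, and products are associative. It merges the initial state
with the earlier samples. -/
theorem indepFun_prodMk_left_of_indepFun {α β γ : Type*} [MeasurableSpace α] [MeasurableSpace β]
    [MeasurableSpace γ] {U : S → α} {V : S → β} {T : S → γ} (hU : Measurable U)
    (hV : Measurable V) (hT : Measurable T) (h1 : IndepFun U (fun ω => (V ω, T ω)) μ)
    (h2 : IndepFun V T μ) : IndepFun (fun ω => (U ω, V ω)) T μ := by
  have := Measure.isProbabilityMeasure_map (μ := μ) hU.aemeasurable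
  have := Measure.isProbabilityMeasure_map (μ := μ) hV.aemeasurable
  have := Measure.isProbabilityMeasure_map (μ := μ) hT.aemeasurable
  have h3 : IndepFun U V μ := h1.comp measurable_id measurable_fst
  rw [indepFun_iff_map_prod_eq_prod_map_map (by fun_prop) (by fun_prop)] at h1 h2 h3 ⊢
  rw [h3]
  have h4 : Measure.map (fun ω => ((U ω, V ω), T ω)) μ =
      Measure.map MeasurableEquiv.prodAssoc.symm (Measure.map (fun ω => (U ω, (V ω, T ω))) μ) := by
    rw [Measure.map_map (by fun_prop) (by fun_prop)]
    rfl
  rw [h4, h1, h2, ← Measure.prodAssoc_prod, Measure.map_map (by fun_prop) (by fun_prop)]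
  simp

theorem comap_subfamily_le {S ι β κ : Type*} [MeasurableSpace β] (ξ : ι → S → β) (a : κ → ι) :
    MeasurableSpace.comap (fun ω (p : κ) => ξ (a p) ω) MeasurableSpace.pi ≤
      ⨆ i ∈ Set.range a, MeasurableSpace.comap (ξ i) inferInstance := by
  refine Measurable.comap_le (@measurable_pi_lambda _ _ _ (_) _ _ fun p => ?_)
  refine Measurable.mono (comap_measurable (ξ (a p))) ?_ le_rfl
  exact le_iSup₂_of_le (f := fun i (_ : i ∈ Set.range a) => MeasurableSpace.comap (ξ i) _)
    (a p) ⟨p, rfl⟩ le_rfl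

theorem indepFun_restrict_of_disjoint {S : Type*} [MeasurableSpace S] {μ : Measure S} {ι β : Type*} [MeasurableSpace β] {ξ : ι → S → β}
    (hξ : ∀ i, Measurable (ξ i)) (h : iIndepFun ξ μ) {κ κ' : Type*} (a : κ → ι) (b : κ' → ι)
    (hab : Disjoint (Set.range a) (Set.range b)) :
    IndepFun (fun ω (p : κ) => ξ (a p) ω) (fun ω (p : κ') => ξ (b p) ω) μ := by
  have h1 := indep_iSup_of_disjoint (fun i => (hξ i).comap_le) h.iIndep hab
  rw [IndepFun_iff_Indep]
  exact indep_of_indep_of_le_left (indep_of_indep_of_le_right h1 (comap_subfamily_le ξ b))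
    (comap_subfamily_le ξ a)

/-- Freezing argument: under the product law, Tonelli allows `X` to be held fixed. It takes the
place of conditional expectation. -/
theorem lintegral_comp_le_of_indepFun {α β : Type*} [MeasurableSpace α] [MeasurableSpace β]
    {X : S → α} {Y : S → β} (hX : Measurable X) (hY : Measurable Y) (h : IndepFun X Y μ)
    {Φ : α × β → ℝ≥0∞} (hΦ : Measurable Φ) {v : ℝ≥0∞} (hv : ∀ ω, ∫⁻ ω', Φ (X ω, Y ω') ∂μ ≤ v) :
    ∫⁻ ω, Φ (X ω, Y ω) ∂μ ≤ v := by
  have := Measure.isProbabilityMeasure_map (μ := μ) hX.aemeasurable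
  have := Measure.isProbabilityMeasure_map (μ := μ) hY.aemeasurable
  have h1 : ∫⁻ ω, Φ (X ω, Y ω) ∂μ = ∫⁻ q, Φ q ∂(μ.map X).prod (μ.map Y) := by
    rw [← (indepFun_iff_map_prod_eq_prod_map_map hX.aemeasurable hY.aemeasurable).1 h,
      lintegral_map hΦ (by fun_prop)]
  rw [h1, lintegral_prod _ hΦ.aemeasurable, lintegral_map hΦ.lintegral_prod_right' hX]
  calc ∫⁻ ω, ∫⁻ y, Φ (X ω, y) ∂μ.map Y ∂μ ≤ ∫⁻ _, v ∂μ := by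
        refine lintegral_mono fun ω => ?_
        rw [lintegral_map (by fun_prop) hY]
        exact hv ω
    _ = v := by simp

/-- The second moment of an average of independent centered random vectors. -/
theorem lintegral_enorm_average_sq_le {S : Type*} [MeasurableSpace S] {μ : Measure S}
    [IsFiniteMeasure μ] {d : ℕ} {Y : ℕ → S → EuclideanSpace ℝ (Fin d)}
    (hY : ∀ t, Measurable (Y t)) (hind : Pairwise fun s t => IndepFun (Y s) (Y t) μ)
    (hmean : ∀ t, ∫ ω, Y t ω ∂μ = 0) {v : ℝ≥0∞} (hvtop : v ≠ ∞)
    (hvar : ∀ t, ∫⁻ ω, ‖Y t ω‖ₑ ^ 2 ∂μ ≤ v) (M : ℕ) :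
    ∫⁻ ω, ‖(M : ℝ)⁻¹ • ∑ t ∈ Finset.range M, Y t ω‖ₑ ^ 2 ∂μ ≤ ENNReal.ofReal (M : ℝ)⁻¹ * v := by
  have hL2 : ∀ t, MemLp (Y t) 2 μ := by
    intro t
    refine ⟨(hY t).aestronglyMeasurable, ?_⟩
    rw [eLpNorm_lt_top_iff_lintegral_rpow_enorm_lt_top two_ne_zero ENNReal.ofNat_ne_top]
    simpa using (hvar t).trans_lt hvtop.lt_top
  have hL2' : ∀ t r, MemLp (fun ω => Y t ω r) 2 μ := fun t r =>
    (EuclideanSpace.proj r : EuclideanSpace ℝ (Fin d) →L[ℝ] ℝ).comp_memLp' (hL2 t)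
  have hmean' : ∀ t r, ∫ ω, Y t ω r ∂μ = 0 := by
    intro t r
    have h1 := (EuclideanSpace.proj r : EuclideanSpace ℝ (Fin d) →L[ℝ] ℝ).integral_comp_comm
      ((hL2 t).integrable one_le_two)
    rw [hmean t, map_zero] at h1
    exact h1
  -- In each coordinate, variances of pairwise independent centered variables add.
  have hcoord : ∀ r, ∫ ω, (∑ t ∈ Finset.range M, Y t ω r) ^ 2 ∂μ =
      ∑ t ∈ Finset.range M, ∫ ω, (Y t ω r) ^ 2 ∂μ := by
    intro r
    have h1 := IndepFun.variance_sum (μ := μ) (X := fun t ω => Y t ω r) (s := Finset.range M)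
      (fun t _ => hL2' t r) (fun s _ t _ hst =>
        (hind hst).comp (φ := fun y : EuclideanSpace ℝ (Fin d) => y r)
          (ψ := fun y : EuclideanSpace ℝ (Fin d) => y r) (by fun_prop) (by fun_prop))
    have h2 : ∀ t, variance (fun ω => Y t ω r) μ = ∫ ω, (Y t ω r) ^ 2 ∂μ := fun t =>
      variance_of_integral_eq_zero (hL2' t r).aestronglyMeasurable.aemeasurable (hmean' t r)
    simp only [h2] at h1
    rw [← h1]
    have h3 : (∑ t ∈ Finset.range M, fun ω => Y t ω r) =
        fun ω => ∑ t ∈ Finset.range M, Y t ω r := by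
      ext ω; simp
    rw [h3, variance_of_integral_eq_zero]
    · exact (memLp_finsetSum _ fun t _ => hL2' t r).aestronglyMeasurable.aemeasurable
    · rw [integral_finsetSum _ fun t _ => (hL2' t r).integrable one_le_two]
      exact Finset.sum_eq_zero fun t _ => hmean' t r
  have hsq : ∀ t r, Integrable (fun ω => (Y t ω r) ^ 2) μ := fun t r => (hL2' t r).integrable_sq
  have hnormsq : ∀ Z : S → EuclideanSpace ℝ (Fin d), MemLp Z 2 μ →
      ∫⁻ ω, ‖Z ω‖ₑ ^ 2 ∂μ = ENNReal.ofReal (∫ ω, ‖Z ω‖ ^ 2 ∂μ) := by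
    intro Z hZ
    rw [ofReal_integral_eq_lintegral_ofReal hZ.norm.integrable_sq
      (.of_forall fun ω => sq_nonneg _)]
    refine lintegral_congr fun ω => ?_
    rw [ENNReal.ofReal_pow (norm_nonneg _), ofReal_norm]
  have hsum : ∫ ω, ‖∑ t ∈ Finset.range M, Y t ω‖ ^ 2 ∂μ =
      ∑ t ∈ Finset.range M, ∫ ω, ‖Y t ω‖ ^ 2 ∂μ := by
    have e1 : ∀ ω, ‖∑ t ∈ Finset.range M, Y t ω‖ ^ 2 =
        ∑ r, (∑ t ∈ Finset.range M, Y t ω r) ^ 2 := by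
      intro ω
      rw [EuclideanSpace.real_norm_sq_eq]
      simp
    simp only [e1, EuclideanSpace.real_norm_sq_eq]
    rw [integral_finsetSum _ fun r _ => (memLp_finsetSum _ fun t _ => hL2' t r).integrable_sq]
    simp only [hcoord]
    rw [Finset.sum_comm]
    exact Finset.sum_congr rfl fun t _ => (integral_finsetSum _ fun r _ => hsq t r).symm
  have hle : ∫⁻ ω, ‖∑ t ∈ Finset.range M, Y t ω‖ₑ ^ 2 ∂μ ≤ M * v := by
    rw [hnormsq _ (memLp_finsetSum _ fun t _ => hL2 t), hsum,
      ENNReal.ofReal_sum_of_nonneg fun t _ => integral_nonneg fun ω => sq_nonneg _]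
    calc ∑ t ∈ Finset.range M, ENNReal.ofReal (∫ ω, ‖Y t ω‖ ^ 2 ∂μ)
        ≤ ∑ t ∈ Finset.range M, v := Finset.sum_le_sum fun t _ => by
          rw [← hnormsq _ (hL2 t)]; exact hvar t
      _ = M * v := by simp
  rcases Nat.eq_zero_or_pos M with rfl | hM
  · simp
  have hM' : (0 : ℝ) < M := Nat.cast_pos.2 hM
  have e2 : ∀ ω, ‖(M : ℝ)⁻¹ • ∑ t ∈ Finset.range M, Y t ω‖ₑ ^ 2 =
      ENNReal.ofReal ((M : ℝ)⁻¹ ^ 2) * ‖∑ t ∈ Finset.range M, Y t ω‖ₑ ^ 2 := by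
    intro ω
    rw [enorm_smul, mul_pow, Real.enorm_of_nonneg (by positivity),
      ENNReal.ofReal_pow (by positivity)]
  simp only [e2]
  rw [lintegral_const_mul' _ _ ENNReal.ofReal_ne_top]
  calc ENNReal.ofReal ((M : ℝ)⁻¹ ^ 2) * ∫⁻ ω, ‖∑ t ∈ Finset.range M, Y t ω‖ₑ ^ 2 ∂μ
      ≤ ENNReal.ofReal ((M : ℝ)⁻¹ ^ 2) * (M * v) := by gcongr
    _ = ENNReal.ofReal ((M : ℝ)⁻¹ ^ 2) * ENNReal.ofReal M * v := by
      rw [ENNReal.ofReal_natCast, mul_assoc]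
    _ = ENNReal.ofReal (M : ℝ)⁻¹ * v := by
      rw [← ENNReal.ofReal_mul (by positivity)]
      congr 2
      field_simp

end Independence

/-! ### A jointly measurable version of the partial gradient. -/

section MeasurableGradient

variable {N m : ℕ} {n : Fin N → ℕ} {Ξ : Fin N → Type*} [∀ i, MeasurableSpace (Ξ i)]
  {𝒢 : Game m n Ξ} {D : ∀ i, Set (EuclideanSpace ℝ (Fin (n i)))}

/-- The partial gradient as an upper limit of difference quotients: a jointly measurable function,
which agrees with the partial gradient on the domain of the pseudogradient. -/
def Game.measGrad (𝒢 : Game m n Ξ) (i : Fin N) (q : Dec n × Ξ i) : EuclideanSpace ℝ (Fin (n i)) :=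
  WithLp.toLp 2 fun r => limsup (fun k : ℕ => ((k : ℝ) + 1) *
    (𝒢.f i (Function.update q.1 i (q.1 i + ((k : ℝ) + 1)⁻¹ • EuclideanSpace.single r 1)) q.2
      - 𝒢.f i q.1 q.2)) atTop

theorem Game.Regular.measurable_measGrad (h𝒢 : 𝒢.Regular D) (i : Fin N) :
    Measurable (𝒢.measGrad i) := by
  refine (PiLp.continuous_toLp 2 _).measurable.comp (measurable_pi_lambda _ fun r => ?_)
  refine Measurable.limsup fun k => ?_
  have h1 : Measurable fun q : Dec n × Ξ i => (Function.update q.1 i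
      (q.1 i + ((k : ℝ) + 1)⁻¹ • EuclideanSpace.single r (1 : ℝ)), q.2) := by
    refine Measurable.prodMk (measurable_pi_lambda _ fun j => ?_) measurable_snd
    rcases eq_or_ne j i with rfl | hj
    · simp only [Function.update_self]
      fun_prop
    · simp only [Function.update_of_ne hj]
      fun_prop
  exact (((h𝒢.f_meas i).comp h1).sub (h𝒢.f_meas i)).const_mul _

/-- On the domain the difference quotients converge, so the upper limit is the partial derivative.
Off it `measGrad` stays measurable, so no measurability of `D` is needed. -/
theorem Game.Regular.measGrad_eq (h𝒢 : 𝒢.Regular D) (i : Fin N) {x : Dec n}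
    (hx : ∀ j, x j ∈ D j) (ξ : Ξ i) : 𝒢.measGrad i (x, ξ) = 𝒢.grad i x ξ := by
  ext r
  have hdiff := (h𝒢.f_smooth i x hx ξ).differentiable one_ne_zero
  have hgrad : HasGradientAt (fun y => 𝒢.f i (Function.update x i y) ξ) (𝒢.grad i x ξ) (x i) :=
    (hdiff (x i)).hasGradientAt
  set e : EuclideanSpace ℝ (Fin (n i)) := EuclideanSpace.single r 1 with he
  have hline : HasDerivAt (fun t : ℝ => 𝒢.f i (Function.update x i (x i + t • e)) ξ)
      ⟪𝒢.grad i x ξ, e⟫ 0 := by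
    have h2 : HasDerivAt (fun t : ℝ => x i + t • e) e 0 := by
      simpa using ((hasDerivAt_id (0 : ℝ)).smul_const e).const_add (x i)
    have h3 : HasFDerivAt (fun y => 𝒢.f i (Function.update x i y) ξ)
        (InnerProductSpace.toDual ℝ _ (𝒢.grad i x ξ)) (x i + (0 : ℝ) • e) := by
      simpa using hgrad.hasFDerivAt
    have := h3.comp_hasDerivAt (0 : ℝ) h2
    simpa [Function.comp_def] using this
  have hslope := hline.tendsto_slope_zero_right
  have hseq : Tendsto (fun k : ℕ => ((k : ℝ) + 1)⁻¹) atTop (𝓝[>] 0) := by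
    refine tendsto_nhdsWithin_iff.2 ⟨?_, .of_forall fun k => ?_⟩
    · simpa using tendsto_one_div_add_atTop_nhds_zero_nat (𝕜 := ℝ)
    · have : (0 : ℝ) < ((k : ℝ) + 1)⁻¹ := by positivity
      exact this
  have hlim := hslope.comp hseq
  have h4 : ⟪𝒢.grad i x ξ, e⟫ = 𝒢.grad i x ξ r := by
    rw [he, EuclideanSpace.inner_single_right]
    simp
  rw [h4] at hlim
  refine Tendsto.limsup_eq (hlim.congr fun k => ?_)
  simp [he]

theorem Game.Regular.stronglyMeasurable_measF (h𝒢 : 𝒢.Regular D) (i : Fin N) :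
    StronglyMeasurable fun x : Dec n => ∫ ξ, 𝒢.measGrad i (x, ξ i) ∂𝒢.P := by
  have := h𝒢.prob
  refine StronglyMeasurable.integral_prod_right
    (f := fun (x : Dec n) (ξ : ∀ i, Ξ i) => 𝒢.measGrad i (x, ξ i)) ?_
  refine Measurable.stronglyMeasurable ?_
  exact (h𝒢.measurable_measGrad i).comp (by fun_prop)

end MeasurableGradient

/-! ### Measurability of the iterates and summability of the sampling errors. -/

section Run

variable {N m : ℕ} {n : Fin N → ℕ} {Ξ : Fin N → Type*} [∀ i, MeasurableSpace (Ξ i)]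
  {𝒢 : Game m n Ξ} {D : ∀ i, Set (EuclideanSpace ℝ (Fin (n i)))}
  {W : Matrix (Fin N) (Fin N) ℝ} {c : ℝ} {α ν δ : Fin N → ℝ} {M : ℕ → ℕ}

/-- Nonexpansiveness gives both continuity of a chosen prox map and uniqueness of the prox point. -/
theorem Game.Regular.exists_measurable_prox (h𝒢 : 𝒢.Regular D) (i : Fin N) {a : ℝ} (ha : 0 ≤ a) :
    ∃ P : EuclideanSpace ℝ (Fin (n i)) → EuclideanSpace ℝ (Fin (n i)), Measurable P ∧
      ∀ v p, 𝒢.IsProx i a v p → p = P v := by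
  choose P hP using fun v => exists_isProxOn (h𝒢.nonempty i) (h𝒢.compact i) (h𝒢.g_lsc i) ha v
  have hlip : LipschitzWith 1 P := LipschitzWith.of_dist_le_mul fun v w => by
    simpa [dist_eq_norm] using (hP v).norm_sub_le (h𝒢.g_convex i) ha (hP w)
  refine ⟨P, hlip.continuous.measurable, fun v p hp => ?_⟩
  have h1 := IsProxOn.norm_sub_le (h𝒢.g_convex i) ha hp.isProxOn (hP v)
  rw [sub_self, norm_zero] at h1
  exact sub_eq_zero.1 (norm_le_zero_iff.1 h1)

/-- One iteration preserves measurability. -/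
theorem measurable_step (h𝒢 : 𝒢.Regular D) (hα : ∀ i, 0 < α i) {S : Type*} [MeasurableSpace S]
    {ξ : ℕ → ℕ → S → ∀ i, Ξ i} {X : ℕ → S → Fin N → Dec n} {z l : ℕ → S → Fin N → Fin m → ℝ}
    (htr : ∀ ω, IsTrajectory 𝒢 W c α ν δ M (fun k t => ξ k t ω) (fun k => X k ω)
      (fun k => z k ω) (fun k => l k ω)) (hX : ∀ k ω i j, X k ω i j ∈ D j) (k : ℕ)
    (hξ : ∀ t, Measurable (ξ k t)) (hXm : Measurable (X k)) (hzm : Measurable (z k))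
    (hlm : Measurable (l k)) :
    Measurable (X (k + 1)) ∧ Measurable (z (k + 1)) ∧ Measurable (l (k + 1)) := by
  have hXi : ∀ i, Measurable fun ω => X k ω i := fun i => (measurable_pi_apply i).comp hXm
  have hXij : ∀ i j, Measurable fun ω => X k ω i j := fun i j =>
    (measurable_pi_apply j).comp (hXi i)
  have hzi : ∀ i, Measurable fun ω => z k ω i := fun i => (measurable_pi_apply i).comp hzm
  have hli : ∀ i, Measurable fun ω => l k ω i := fun i => (measurable_pi_apply i).comp hlm
  have hX' : Measurable (X (k + 1)) := by
    refine measurable_pi_lambda _ fun i => measurable_pi_lambda _ fun j => ?_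
    rcases eq_or_ne j i with rfl | hj
    · obtain ⟨P, hPm, hP⟩ := h𝒢.exists_measurable_prox j (hα j).le
      have h1 : (fun ω => X (k + 1) ω j j) = fun ω => P (X k ω j j - α j •
          ((M k : ℝ)⁻¹ • ∑ t ∈ Finset.range (M k), 𝒢.measGrad j (X k ω j, ξ k t ω j) +
            𝒢.mulAT j (l k ω j) + c • ∑ h, W j h • (X k ω j j - X k ω h j))) := by
        funext ω
        rw [hP _ _ ((htr ω).decision k j)]
        simp only [Game.sampledF, h𝒢.measGrad_eq j (hX k ω j)]
      rw [h1]
      have h2 : Measurable fun ω => 𝒢.mulAT j (l k ω j) :=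
        (Game.continuous_mulAT j).measurable.comp (hli j)
      have h3 : ∀ t, Measurable fun ω => 𝒢.measGrad j (X k ω j, ξ k t ω j) := fun t =>
        (h𝒢.measurable_measGrad j).comp
          ((hXi j).prodMk ((measurable_pi_apply j).comp (hξ t)))
      have h4 : Measurable fun ω => ∑ t ∈ Finset.range (M k), 𝒢.measGrad j (X k ω j, ξ k t ω j) :=
        Finset.measurable_fun_sum _ fun t _ => h3 t
      have h5 : Measurable fun ω => ∑ h, W j h • (X k ω j j - X k ω h j) :=
        Finset.measurable_fun_sum _ fun h _ => ((hXij j j).sub (hXij h j)).fun_const_smul _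
      exact hPm.comp ((hXij j j).sub
        ((((h4.fun_const_smul _).add h2).add (h5.fun_const_smul _)).fun_const_smul _))
    · have h1 : (fun ω => X (k + 1) ω i j) = fun ω =>
          X k ω i j - (α i * c) • ∑ h, W i h • (X k ω i j - X k ω h j) :=
        funext fun ω => (htr ω).estimate k i j hj
      rw [h1]
      have h5 : Measurable fun ω => ∑ h, W i h • (X k ω i j - X k ω h j) :=
        Finset.measurable_fun_sum _ fun h _ => ((hXij i j).sub (hXij h j)).fun_const_smul _
      exact (hXij i j).sub (h5.fun_const_smul _)
  have hz' : Measurable (z (k + 1)) := by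
    refine measurable_pi_lambda _ fun i => ?_
    have h1 : (fun ω => z (k + 1) ω i) = fun ω =>
        z k ω i + ν i • ∑ j, W i j • (l k ω i - l k ω j) :=
      funext fun ω => (htr ω).auxiliary k i
    rw [h1]
    have h5 : Measurable fun ω => ∑ j, W i j • (l k ω i - l k ω j) :=
      Finset.measurable_fun_sum _ fun j _ => ((hli i).sub (hli j)).fun_const_smul _
    exact (hzi i).add (h5.fun_const_smul _)
  refine ⟨hX', hz', measurable_pi_lambda _ fun i => ?_⟩
  have hzi' : ∀ i, Measurable fun ω => z (k + 1) ω i := fun i => (measurable_pi_apply i).comp hz'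
  have h1 : (fun ω => l (k + 1) ω i) = fun ω => (l k ω i + δ i •
      (𝒢.mulA i ((2 : ℝ) • X (k + 1) ω i i - X k ω i i) - 𝒢.b i
      - ∑ j, W i j • ((2 : ℝ) • (z (k + 1) ω i - z (k + 1) ω j) - (z k ω i - z k ω j)))) ⊔ 0 :=
    funext fun ω => (htr ω).dual k i
  rw [h1]
  have h2 : Measurable fun ω => 𝒢.mulA i ((2 : ℝ) • X (k + 1) ω i i - X k ω i i) := by
    refine (Game.continuous_mulA i).measurable.comp (Measurable.sub ?_ (hXij i i))
    exact ((measurable_pi_apply i).comp ((measurable_pi_apply i).comp hX')).fun_const_smul _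
  have h5 : Measurable fun ω =>
      ∑ j, W i j • ((2 : ℝ) • (z (k + 1) ω i - z (k + 1) ω j) - (z k ω i - z k ω j)) :=
    Finset.measurable_fun_sum _ fun j _ => ((((hzi' i).sub (hzi' j)).fun_const_smul _).sub
      ((hzi i).sub (hzi j))).fun_const_smul _
  have h6 : Measurable fun ω => l k ω i + δ i •
      (𝒢.mulA i ((2 : ℝ) • X (k + 1) ω i i - X k ω i i) - 𝒢.b i
      - ∑ j, W i j • ((2 : ℝ) • (z (k + 1) ω i - z (k + 1) ω j) - (z k ω i - z k ω j))) :=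
    (hli i).add (((h2.sub_const _).sub h5).fun_const_smul _)
  refine measurable_pi_lambda _ fun r => ?_
  exact ((measurable_pi_apply r).comp h6).sup measurable_const

variable {S : Type*} [MeasurableSpace S] {μ : Measure S}
  {ξ : ℕ → ℕ → S → ∀ i, Ξ i} {X : ℕ → S → Fin N → Dec n} {z l : ℕ → S → Fin N → Fin m → ℝ}

/-- The initial state and the samples of the batches before `k`. -/
def past (ξ : ℕ → ℕ → S → ∀ i, Ξ i) (X : ℕ → S → Fin N → Dec n) (z l : ℕ → S → Fin N → Fin m → ℝ)
    (k : ℕ) (ω : S) : ((Fin N → Dec n) × (Fin N → Fin m → ℝ) × (Fin N → Fin m → ℝ)) ×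
      ({p : ℕ × ℕ // p.1 < k} → ∀ i, Ξ i) :=
  ((X 0 ω, z 0 ω, l 0 ω), fun p => ξ p.1.1 p.1.2 ω)

/-- Batch `k` first enters the state at time `k + 1`, hence the strict inequality in `past`. -/
theorem IsRun.measurable_past (h𝒢 : 𝒢.Regular D) (hα : ∀ i, 0 < α i)
    (hrun : IsRun 𝒢 D W c α ν δ M μ ξ X z l) (hX : ∀ k ω i j, X k ω i j ∈ D j) (k : ℕ) :
    Measurable[MeasurableSpace.comap (past ξ X z l k) inferInstance] (X k) ∧
    Measurable[MeasurableSpace.comap (past ξ X z l k) inferInstance] (z k) ∧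
    Measurable[MeasurableSpace.comap (past ξ X z l k) inferInstance] (l k) := by
  induction k with
  | zero =>
    have h1 : Measurable[MeasurableSpace.comap (past ξ X z l 0) inferInstance]
        (past ξ X z l 0) := comap_measurable _
    exact ⟨h1.fst.fst, h1.fst.snd.fst, h1.fst.snd.snd⟩
  | succ k ih =>
    have hle : MeasurableSpace.comap (past ξ X z l k) inferInstance ≤
        MeasurableSpace.comap (past ξ X z l (k + 1)) inferInstance := by
      have h1 : Measurable[MeasurableSpace.comap (past ξ X z l (k + 1)) inferInstance]
          (past ξ X z l (k + 1)) := comap_measurable _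
      refine Measurable.comap_le (Measurable.prodMk h1.fst ?_)
      refine @measurable_pi_lambda _ _ _ (_) _ _ fun p => ?_
      exact (measurable_pi_apply (⟨p.1, p.2.trans (Nat.lt_succ_self k)⟩ :
        {p : ℕ × ℕ // p.1 < k + 1})).comp h1.snd
    -- The step lemma is applied with the σ-algebra of the past in place of the ambient one.
    refine @measurable_step _ _ _ _ _ _ _ _ _ _ _ _ _ h𝒢 hα S
      (MeasurableSpace.comap (past ξ X z l (k + 1)) inferInstance) ξ X z l hrun.trajectory hX k
      (fun t => ?_) (ih.1.mono hle le_rfl) (ih.2.1.mono hle le_rfl) (ih.2.2.mono hle le_rfl)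
    exact (measurable_pi_apply (⟨(k, t), Nat.lt_succ_self k⟩ :
        {p : ℕ × ℕ // p.1 < k + 1})).comp (comap_measurable (past ξ X z l (k + 1))).snd

theorem IsRun.measurable_decision (h𝒢 : 𝒢.Regular D) (hα : ∀ i, 0 < α i)
    (hrun : IsRun 𝒢 D W c α ν δ M μ ξ X z l) (hX : ∀ k ω i j, X k ω i j ∈ D j) (k : ℕ) :
    Measurable (X k) := by
  refine (hrun.measurable_past h𝒢 hα hX k).1.mono (Measurable.comap_le ?_) le_rfl
  exact hrun.init_meas.prodMk (measurable_pi_lambda _ fun p => hrun.sample_meas _ _)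

/-- The iterate is independent of the next batch of samples. -/
theorem IsRun.indepFun_batch [IsProbabilityMeasure μ] (h𝒢 : 𝒢.Regular D) (hα : ∀ i, 0 < α i)
    (hrun : IsRun 𝒢 D W c α ν δ M μ ξ X z l) (hX : ∀ k ω i j, X k ω i j ∈ D j) (k : ℕ) :
    IndepFun (X k) (fun ω t => ξ k t ω) μ := by
  have hV : Measurable fun ω (p : {p : ℕ × ℕ // p.1 < k}) => ξ p.1.1 p.1.2 ω :=
    measurable_pi_lambda _ fun p => hrun.sample_meas _ _
  have hT : Measurable fun ω (t : ℕ) => ξ k t ω := measurable_pi_lambda _ fun t =>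
    hrun.sample_meas _ _
  have h1 : IndepFun (fun ω (p : {p : ℕ × ℕ // p.1 < k}) => ξ p.1.1 p.1.2 ω)
      (fun ω (t : ℕ) => ξ k t ω) μ := by
    refine indepFun_restrict_of_disjoint (ξ := fun (p : ℕ × ℕ) => ξ p.1 p.2)
      (fun p => hrun.sample_meas _ _) hrun.sample_indep
      (fun p : {p : ℕ × ℕ // p.1 < k} => p.1) (fun t => (k, t)) ?_
    rw [Set.disjoint_left]
    rintro _ ⟨p, rfl⟩ ⟨t, ht⟩
    have h : k = p.1.1 := congrArg Prod.fst ht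
    exact p.2.ne h.symm
  have h2 : IndepFun (fun ω => (X 0 ω, z 0 ω, l 0 ω))
      (fun ω => ((fun p : {p : ℕ × ℕ // p.1 < k} => ξ p.1.1 p.1.2 ω), fun t : ℕ => ξ k t ω)) μ :=
    hrun.init_indep.comp (φ := id)
      (ψ := fun s : ℕ × ℕ → ∀ i, Ξ i =>
        ((fun p : {p : ℕ × ℕ // p.1 < k} => s p.1), fun t : ℕ => s (k, t)))
      measurable_id (by fun_prop)
  have h3 : IndepFun (past ξ X z l k) (fun ω (t : ℕ) => ξ k t ω) μ :=
    indepFun_prodMk_left_of_indepFun hrun.init_meas hV hT h2 h1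
  rw [IndepFun_iff_Indep] at h3 ⊢
  exact indep_of_indep_of_le_left h3 (hrun.measurable_past h𝒢 hα hX k).1.comap_le

/-- Squared error of the average of `M` sampled partial gradients. -/
def Game.batchError (𝒢 : Game m n Ξ) (M : ℕ) (i : Fin N)
    (q : (Fin N → Dec n) × (ℕ → ∀ i, Ξ i)) : ℝ≥0∞ :=
  ‖(M : ℝ)⁻¹ • ∑ t ∈ Finset.range M, (𝒢.measGrad i (q.1 i, q.2 t i) -
    ∫ ζ, 𝒢.measGrad i (q.1 i, ζ i) ∂𝒢.P)‖ₑ ^ 2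

theorem Game.Regular.measurable_batchError (h𝒢 : 𝒢.Regular D) (M : ℕ) (i : Fin N) :
    Measurable (𝒢.batchError M i) := by
  have h1 : Measurable fun q : (Fin N → Dec n) × (ℕ → ∀ i, Ξ i) =>
      ∫ ζ, 𝒢.measGrad i (q.1 i, ζ i) ∂𝒢.P :=
    (h𝒢.stronglyMeasurable_measF i).measurable.comp ((measurable_pi_apply i).comp measurable_fst)
  have h2 : ∀ t, Measurable fun q : (Fin N → Dec n) × (ℕ → ∀ i, Ξ i) =>
      𝒢.measGrad i (q.1 i, q.2 t i) := fun t =>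
    (h𝒢.measurable_measGrad i).comp (by fun_prop)
  exact ((Finset.measurable_fun_sum _ fun t _ => (h2 t).sub h1).fun_const_smul _).enorm.pow_const 2

/-- Second moment of the error of a batch of samples at a fixed point. -/
theorem IsRun.lintegral_batch_error_le [IsProbabilityMeasure μ] (h𝒢 : 𝒢.Regular D)
    (hrun : IsRun 𝒢 D W c α ν δ M μ ξ X z l) {σ : ℝ} (hvar : 𝒢.BoundedVariance D σ) (i : Fin N)
    {x : Dec n} (hx : ∀ j, x j ∈ D j) (k : ℕ) :
    ∫⁻ ω, ‖(M k : ℝ)⁻¹ • ∑ t ∈ Finset.range (M k), (𝒢.measGrad i (x, ξ k t ω i) -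
      ∫ ξ, 𝒢.measGrad i (x, ξ i) ∂𝒢.P)‖ₑ ^ 2 ∂μ ≤
      ENNReal.ofReal (M k : ℝ)⁻¹ * ENNReal.ofReal (σ ^ 2) := by
  have := h𝒢.prob
  have hF : ∫ ξ, 𝒢.measGrad i (x, ξ i) ∂𝒢.P = 𝒢.F i x := by
    simp only [h𝒢.measGrad_eq i hx, Game.F]
  rw [hF]
  have hg : Measurable fun ζ : ∀ i, Ξ i => 𝒢.measGrad i (x, ζ i) - 𝒢.F i x :=
    ((h𝒢.measurable_measGrad i).comp (by fun_prop)).sub_const _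
  have hint : Integrable (fun ζ : ∀ i, Ξ i => 𝒢.measGrad i (x, ζ i)) 𝒢.P := by
    simpa only [h𝒢.measGrad_eq i hx] using h𝒢.grad_integrable i x hx
  refine lintegral_enorm_average_sq_le (Y := fun t ω => 𝒢.measGrad i (x, ξ k t ω i) - 𝒢.F i x)
    (fun t => hg.comp (hrun.sample_meas k t)) (fun s t hst => ?_) (fun t => ?_)
    ENNReal.ofReal_ne_top (fun t => ?_) (M k)
  · exact (hrun.sample_indep.indepFun (i := (k, s)) (j := (k, t)) (by simpa using hst)).comp hg hg
  · rw [← integral_map (μ := μ) (φ := ξ k t) (f := fun ζ => 𝒢.measGrad i (x, ζ i) - 𝒢.F i x)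
      (hrun.sample_meas k t).aemeasurable hg.aestronglyMeasurable, hrun.sample_law,
      integral_sub hint (integrable_const _), hF]
    simp
  · have hsq : Measurable fun ζ : ∀ i, Ξ i => ‖𝒢.measGrad i (x, ζ i) - 𝒢.F i x‖ₑ ^ 2 :=
      hg.enorm.pow_const 2
    have h1 := lintegral_map (μ := μ) hsq (hrun.sample_meas k t)
    rw [hrun.sample_law] at h1
    rw [← h1]
    refine le_trans (lintegral_mono fun ζ => ?_) (hvar x hx)
    rw [h𝒢.measGrad_eq i hx]
    exact Finset.single_le_sum (f := fun i => ‖𝒢.grad i x (ζ i) - 𝒢.F i x‖ₑ ^ 2)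
      (fun _ _ => zero_le) (Finset.mem_univ i)

/-- A positive batch size lets the constant `F` pass into the average. The error becomes a
measurable functional of iterate and batch, as the freezing argument requires. -/
theorem sampling_error_eq {S : Type*} {ξ : ℕ → ℕ → S → ∀ i, Ξ i} {X : ℕ → S → Fin N → Dec n}
    (h𝒢 : 𝒢.Regular D) (hX : ∀ k ω i j, X k ω i j ∈ D j) (hM : ∀ k, 0 < M k) (k : ℕ) (i : Fin N)
    (ω : S) : ‖𝒢.sampledF i (M k) (X k ω i) (fun t => ξ k t ω i) - 𝒢.F i (X k ω i)‖ₑ ^ 2 =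
      𝒢.batchError (M k) i (X k ω, fun t => ξ k t ω) := by
  have hM' : (M k : ℝ) ≠ 0 := Nat.cast_ne_zero.2 (hM k).ne'
  simp only [Game.batchError, Game.sampledF, h𝒢.measGrad_eq i (hX k ω i), Finset.sum_sub_distrib,
    Finset.sum_const, Finset.card_range, smul_sub, ← Nat.cast_smul_eq_nsmul ℝ, smul_smul,
    inv_mul_cancel₀ hM', one_smul, Game.F]

/-- The growth bound starts at `k = 1`, so the first term is dropped before comparing with a
p-series of exponent `a + 1`. -/
theorem summable_inv_batch {M : ℕ → ℕ} (h : ∃ c₀ k₀ a : ℝ, 0 < c₀ ∧ 0 < k₀ ∧ 0 < a ∧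
    ∀ k : ℕ, 1 ≤ k → c₀ * ((k : ℝ) + k₀) ^ (a + 1) ≤ (M k : ℝ)) :
    Summable fun k => (M k : ℝ)⁻¹ := by
  obtain ⟨c₀, k₀, a, hc₀, hk₀, ha, h⟩ := h
  rw [← summable_nat_add_iff 1]
  have h1 := (summable_nat_add_iff 1).2 (Real.summable_one_div_nat_rpow.2 (by linarith : 1 < a + 1))
  refine Summable.of_nonneg_of_le (fun k => by positivity) (fun k => ?_) (h1.mul_left c₀⁻¹)
  have h2 := h (k + 1) (Nat.le_add_left 1 k)
  have hk : (0 : ℝ) < ((k + 1 : ℕ) : ℝ) := by positivity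
  have h3 : ((k + 1 : ℕ) : ℝ) ^ (a + 1) ≤ (((k + 1 : ℕ) : ℝ) + k₀) ^ (a + 1) :=
    Real.rpow_le_rpow hk.le (by linarith) (by linarith)
  have h4 : 0 < ((k + 1 : ℕ) : ℝ) ^ (a + 1) := Real.rpow_pos_of_pos hk _
  rw [one_div, ← mul_inv]
  exact inv_anti₀ (by positivity) ((mul_le_mul_of_nonneg_left h3 hc₀.le).trans h2)

/-- The sampling errors along a run are almost surely square summable. -/
theorem IsRun.ae_summable_sampling_error [IsProbabilityMeasure μ] (h𝒢 : 𝒢.Regular D)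
    (hα : ∀ i, 0 < α i) (hrun : IsRun 𝒢 D W c α ν δ M μ ξ X z l)
    (hX : ∀ k ω i j, X k ω i j ∈ D j) {σ : ℝ} (hvar : 𝒢.BoundedVariance D σ)
    (hM : ∀ k, 0 < M k) (hMsum : Summable fun k => (M k : ℝ)⁻¹) :
    ∀ᵐ ω ∂μ, Summable fun k => ∑ i,
      ‖𝒢.sampledF i (M k) (X k ω i) (fun t => ξ k t ω i) - 𝒢.F i (X k ω i)‖ ^ 2 := by
  have hXm := hrun.measurable_decision h𝒢 hα hX
  have hT : ∀ k, Measurable fun ω (t : ℕ) => ξ k t ω := fun k => measurable_pi_lambda _ fun t =>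
    hrun.sample_meas _ _
  have hbound : ∀ k i, ∫⁻ ω, ‖𝒢.sampledF i (M k) (X k ω i) (fun t => ξ k t ω i) -
      𝒢.F i (X k ω i)‖ₑ ^ 2 ∂μ ≤ ENNReal.ofReal (M k : ℝ)⁻¹ * ENNReal.ofReal (σ ^ 2) := by
    intro k i
    simp only [sampling_error_eq h𝒢 hX hM]
    exact lintegral_comp_le_of_indepFun (hXm k) (hT k) (hrun.indepFun_batch h𝒢 hα hX k)
      (h𝒢.measurable_batchError (M k) i) fun ω => hrun.lintegral_batch_error_le h𝒢 hvar i (hX k ω i) k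
  have hmeas : ∀ k i, Measurable fun ω => ‖𝒢.sampledF i (M k) (X k ω i) (fun t => ξ k t ω i) -
      𝒢.F i (X k ω i)‖ₑ ^ 2 := by
    intro k i
    simp only [sampling_error_eq h𝒢 hX hM]
    exact (h𝒢.measurable_batchError (M k) i).comp ((hXm k).prodMk (hT k))
  have hmeas' : ∀ k, Measurable fun ω => ∑ i, ‖𝒢.sampledF i (M k) (X k ω i)
      (fun t => ξ k t ω i) - 𝒢.F i (X k ω i)‖ₑ ^ 2 := fun k =>
    Finset.measurable_fun_sum _ fun i _ => hmeas k i
  -- By Tonelli the expected total error is at most a multiple of ∑ 1/M_k; a finite expectation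
  -- gives almost sure finiteness.
  have hfin : ∫⁻ ω, ∑' k, ∑ i, ‖𝒢.sampledF i (M k) (X k ω i) (fun t => ξ k t ω i) -
      𝒢.F i (X k ω i)‖ₑ ^ 2 ∂μ ≠ ∞ := by
    rw [lintegral_tsum fun k => (hmeas' k).aemeasurable]
    refine ne_top_of_le_ne_top (b := ∑' k, ENNReal.ofReal (M k : ℝ)⁻¹ *
      (N * ENNReal.ofReal (σ ^ 2))) ?_ (ENNReal.tsum_le_tsum fun k => ?_)
    · rw [ENNReal.tsum_mul_right]
      refine ENNReal.mul_ne_top ?_ (ENNReal.mul_ne_top (ENNReal.natCast_ne_top N)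
        ENNReal.ofReal_ne_top)
      exact hMsum.tsum_ofReal_ne_top
    · rw [lintegral_finsetSum _ fun i _ => hmeas k i]
      refine (Finset.sum_le_sum fun i _ => hbound k i).trans_eq ?_
      simp only [Finset.sum_const, Finset.card_univ, Fintype.card_fin, nsmul_eq_mul]
      ring
  filter_upwards [ae_lt_top (Measurable.tsum hmeas') hfin] with ω hω
  refine (ENNReal.summable_toReal hω.ne).congr fun k => ?_
  rw [ENNReal.toReal_sum fun i _ => ENNReal.pow_ne_top enorm_ne_top]
  exact Finset.sum_congr rfl fun i _ => by simp

end Run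

end SGNE

end

theorem theorem1 {N m : ℕ} {n : Fin N → ℕ} {Ξ : Fin N → Type*} [∀ i, MeasurableSpace (Ξ i)]
    (𝒢 : SGNE.Game m n Ξ) (D : ∀ i, Set (EuclideanSpace ℝ (Fin (n i)))) (h𝒢 : 𝒢.Regular D)
    -- strong monotonicity and Lipschitz constants of the (extended) pseudogradient
    (η ℓF ℓp : ℝ) (hη : 0 < η) (hℓF : 0 < ℓF) (hℓp : 0 < ℓp)
    (hmono : 𝒢.StronglyMonotone D η) (hlip : 𝒢.Lipschitz D ℓF) (hext : 𝒢.ExtLipschitz D ℓp)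
    (σ : ℝ) (hvar : 𝒢.BoundedVariance D σ)
    -- connected undirected communication graph
    (G : SimpleGraph (Fin N)) (hG : G.Connected) (W : Matrix (Fin N) (Fin N) ℝ)
    (hW : SGNE.IsWeightMatrix G W)
    -- `c * λ₂(L) > (ℓp + ℓF)² / (4 η) + ℓp`, with `λ₂(L)` the smallest nonzero eigenvalue of `L`
    (c : ℝ) (hc : ∀ r : ℝ, Module.End.HasEigenvalue (Matrix.toLin' (SGNE.laplacian W)) r → r ≠ 0 →
      (ℓp + ℓF) ^ 2 / (4 * η) + ℓp < c * r) :
    ∃ xs : SGNE.Dec n, 𝒢.IsVSGNE xs ∧ (∀ y, 𝒢.IsVSGNE y → y = xs) ∧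
      ∃ αbar νbar δbar : ℝ, 0 < αbar ∧ 0 < νbar ∧ 0 < δbar ∧
        ∀ α ν δ : Fin N → ℝ, (∀ i, α i ∈ Set.Ioo 0 αbar) → (∀ i, ν i ∈ Set.Ioo 0 νbar) →
          (∀ i, δ i ∈ Set.Ioo 0 δbar) →
        -- increasing batch sizes
        ∀ M : ℕ → ℕ, (∀ k, 0 < M k) →
          (∃ c₀ k₀ a : ℝ, 0 < c₀ ∧ 0 < k₀ ∧ 0 < a ∧
            ∀ k : ℕ, 1 ≤ k → c₀ * ((k : ℝ) + k₀) ^ (a + 1) ≤ (M k : ℝ)) →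
        ∀ {S : Type*} [MeasurableSpace S] (μ : Measure S) [IsProbabilityMeasure μ]
          (ξ : ℕ → ℕ → S → ∀ i, Ξ i) (X : ℕ → S → Fin N → SGNE.Dec n)
          (z l : ℕ → S → Fin N → Fin m → ℝ),
          SGNE.IsRun 𝒢 D W c α ν δ M μ ξ X z l →
          ∀ᵐ ω ∂μ, Tendsto (fun k => (fun i => X k ω i i : SGNE.Dec n)) atTop (𝓝 xs) := by
  obtain ⟨xs, ls, hkkt⟩ := SGNE.Game.exists_isKKT h𝒢 hη hℓF hmono hlip
  obtain ⟨αbar, νbar, δbar, hαb, hνb, hδb, hconv⟩ := SGNE.exists_stepsizes h𝒢 hη hℓF hℓp hmono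
    hlip hext hG hW hc hkkt
  refine ⟨xs, hkkt.isVSGNE h𝒢, fun y hy =>
    SGNE.Game.SolvesSVI.unique h𝒢 hη hmono hkkt.solvesSVI hy.2, αbar, νbar, δbar, hαb, hνb, hδb,
    ?_⟩
  intro α ν δ hα hν hδ M hM hMk S _ μ _ ξ X z l hrun
  -- The estimates stay in `D` on every path; only the summability of the errors is almost sure.
  have hpath := fun ω => hconv α ν δ hα hν hδ M _ _ _ _ (hrun.trajectory ω)
    (hrun.init_estimate ω)
  filter_upwards [hrun.ae_summable_sampling_error h𝒢 (fun i => (hα i).1)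
    (fun k ω => (hpath ω).1 k) hvar hM (SGNE.summable_inv_batch hMk)] with ω hω
  exact (hpath ω).2 hω
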